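/- Let $K$ be a field with algebraic closure $\overline K$, let $k,n\ge 0$, let $Gr$ be the Grassmannian of $k$-dimensional subspaces of $K^n$ (row spans of $k\times n$ matrices of rank $k$) in its Plücker embedding, with Plücker coordinates $p_S$ for $S\subseteq[n]$, $|S|=k$, and let $T\le GL_n$ be the diagonal torus. For $S\subseteq [n]$ let $coord(S)$ be the subspace of vectors that use only coordinates from $S$. For a set $Y$ of $k$-dimensional subspaces let $Y^T$ be the set of its $T$-fixed elements and $coord^{-1}(Y)=\{S : |S|=k,\ coord(S)\in Y\}$. *Combinatorial shift.* For $m\in[n]$ let $sh_{i\to j}m=j$ if $m=i$, and $sh_{i\to j}m=m$ otherwise. For $S\subseteq[n]$ let $sh_{i\to j}S$ consist of the elements $sh_{i\to j}m$ for those $m\in S$ with $sh_{i\to j}m\notin S$, and $m$ for those $m\in S$ with $sh_{i\to j}m\in S$. For a collection $\mathcal C$ of subsets, $sh_{i\to j}\mathcal C$ is defined from the $sh_{i\to j}S$, $S\in\mathcal C$, by the same rule (replace $S$ by $sh_{i\to j}S$ unless $sh_{i\to j}S\in\mathcal C$). *Geometric shift and sweep.* Let $e_{ij}$ be the matrix unit,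 acting on row vectors from the right. For a closed subscheme $X\subseteq Gr$ and $i\ne j$, let $\widetilde{sw}_{i\to j}X\subseteq\mathbb P^1\times Gr$ be the closure of $\{(t,\exp(te_{ij})\cdot x): t\in\mathbb A^1,\ x\in X\}$. The geometric shift $sh_{i\to j}X$ is its scheme-theoretic fibre over $\infty\in\mathbb P^1$, and the sweep $sw_{i\to j}X$ is its image in $Gr$. *$T$-convexity.* For $M\subseteq[n]$ with $|M|=k-1$ and distinct $a,b\notin M$ let $L=\{V\in Gr: coord(M)<V<coord(M\cup\{a,b\})\}$, so that $L^T=\{coord(M\cup\{a\}),coord(M\cup\{b\})\}$. $X$ is called $T$-convex if $L^T\subseteq X$ implies $L\subseteq X$ for each such $L$ (as sets of $\overline K$-points). **Theorem.** Let $X\subseteq Gr$ be a $T$-invariant closed subscheme. 1. If $X$ is irreducible, then $X$ is $T$-convex. 2. If $X$ is defined by the vanishing of a set of Plücker coordinates, then $X$ is $T$-convex. 3. If $X$ is $T$-convex, then for all $i\neq j$ in $[n]$, with $T$-fixed points taken among the $\overline K$-points, $coord^{-1}\big((sh_{i\to j}X)^T\big)=sh_{i\to j}\big(coord^{-1}(X^T)\big)$.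 4. If $X$ is a variety (irreducible and reduced), $i\ne j$, and the collection $coord^{-1}(X^T)$ is not $sh_{i\to j}$-invariant, that is, $sh_{i\to j}(coord^{-1}(X^T))\ne coord^{-1}(X^T)$, then $\widetilde{sw}_{i\to j}X$ and $sw_{i\to j}X$ are varieties and the projection $\widetilde{sw}_{i\to j}X\to sw_{i\to j}X$ has degree $1$, i.e. it induces an extension of function fields of degree $1$. -/

import Mathlib

universe u

/-! Throughout, `K` is a field, `Gr` is the Grassmannian of `k`-dimensional subspaces of `K ^ n`
in its Plücker embedding, subspaces are row spans of `k × n` matrices, and an `n × n` matrix `g`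
acts on row vectors by `v ↦ v g`. -/

namespace GrassmannShift

open MvPolynomial

/-! ### Combinatorial shifting -/

section Combinatorial

variable {n : ℕ}

/-- The shift of an element: turn `i` into `j`. -/
def shiftElt (i j m : Fin n) : Fin n := if m = i then j else m

/-- The shift of a subset: shift each element, unless the result is already in the subset. -/
def shiftSet (i j : Fin n) (S : Finset (Fin n)) : Finset (Fin n) :=
  S.image fun m => if shiftElt i j m ∈ S then m else shiftElt i j m

open Classical in
/-- The shift of a collection: shift each subset, unless the result is already in the collection. -/
def shiftColl (i j : Fin n) (C : Set (Finset (Fin n))) : Set (Finset (Fin n)) :=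
  (fun S => if shiftSet i j S ∈ C then S else shiftSet i j S) '' C

end Combinatorial

/-! ### Sets of subspaces of `F ^ n`, the torus, and `T`-convexity -/

section Points

variable {F : Type*} [Field F] {n : ℕ}

/-- The coordinate subspace of vectors using only coordinates from `S`. -/
def coord (F : Type*) [Field F] {n : ℕ} (S : Finset (Fin n)) : Submodule F (Fin n → F) where
  carrier := {v | ∀ m, m ∉ S → v m = 0}
  add_mem' hv hw m hm := by simp [hv m hm, hw m hm]
  zero_mem' _ _ := rfl
  smul_mem' c v hv m hm := by simp [hv m hm]

/-- The fixed points, in a set of subspaces, of the torus of invertible diagonal matrices. -/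
def torusFixed (Y : Set (Submodule F (Fin n → F))) : Set (Submodule F (Fin n → F)) :=
  {V ∈ Y | ∀ t : Fin n → Fˣ,
    V.map (Matrix.vecMulLinear (Matrix.diagonal fun m => (t m : F))) = V}

/-- The collection of those `k`-element `S` for which `coord S` belongs to a set of subspaces. -/
def coordInv (k : ℕ) (Y : Set (Submodule F (Fin n → F))) : Set (Finset (Fin n)) :=
  {S | S.card = k ∧ coord F S ∈ Y}

/-- The `T`-invariant line of all `k`-dimensional `V` with `coord M < V < coord (M ∪ {i, j})`. -/
def line (F : Type*) [Field F] {n : ℕ} (k : ℕ) (M : Finset (Fin n)) (i j : Fin n) :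
    Set (Submodule F (Fin n → F)) :=
  {V | Module.finrank F V = k ∧ coord F M < V ∧ V < coord F (insert i (insert j M))}

/-- `Y` contains each `T`-invariant line whose `T`-fixed points it contains. -/
def TConvex (k : ℕ) (Y : Set (Submodule F (Fin n → F))) : Prop :=
  ∀ (M : Finset (Fin n)) (i j : Fin n), M.card + 1 = k → i ∉ M → j ∉ M → i ≠ j →
    torusFixed (line F k M i j) ⊆ Y → line F k M i j ⊆ Y

end Points

/-! ### Plücker coordinates -/

section Pluecker

/-- The `k`-element subsets of `Fin n`, which index the Plücker coordinates. -/
abbrev KSub (n k : ℕ) : Type := Set.powersetCard (Fin n) k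

/-- The elements of `S` in increasing order. -/
def cols {n k : ℕ} (S : KSub n k) : Fin k → Fin n :=
  S.1.orderEmbOfFin (Set.powersetCard.card_eq S)

variable {B : Type*} [CommRing B] {n k : ℕ}

/-- The Plücker coordinates (maximal minors) of a `k × n` matrix. -/
def minors (M : Matrix (Fin k) (Fin n) B) (S : KSub n k) : B :=
  (M.submatrix id (cols S)).det

/-- The action of an `n × n` matrix on Plücker vectors that is induced by `V ↦ V g`,
see `minors_mul`. -/
def actCoord (y : KSub n k → B) (g : Matrix (Fin n) (Fin n) B) (S : KSub n k) : B :=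
  ∑ S' : KSub n k, y S' * (g.submatrix (cols S') (cols S)).det

theorem minors_mul (M : Matrix (Fin k) (Fin n) B) (g : Matrix (Fin n) (Fin n) B) :
    minors (k := k) (M * g) = actCoord (minors M) g := by
  classical
  funext S
  have key := fun x => exteriorPower.basis_repr_apply B k (Pi.basisFun B (Fin n)) x
  have hc : ∀ T : KSub n k, (Set.powersetCard.ofFinEmbEquiv.symm T : Fin k → Fin n) = cols T := by
    intro T; funext a; rfl
  have hM : ∀ (N : Matrix (Fin k) (Fin n) B) (T : KSub n k),
      ((Pi.basisFun B (Fin n)).exteriorPower k).repr (exteriorPower.ιMulti B k N.row) T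
        = minors N T := by
    intro N T
    rw [key, exteriorPower.ιMultiDual_apply_ιMulti, hc]
    rfl
  have hmap : exteriorPower.map k (Matrix.vecMulLinear g) (exteriorPower.ιMulti B k M.row)
      = exteriorPower.ιMulti B k (M * g).row := by
    rw [exteriorPower.map_apply_ιMulti]
    congr 1
  rw [← hM, ← hmap]
  conv_lhs =>
    rw [← ((Pi.basisFun B (Fin n)).exteriorPower k).sum_repr (exteriorPower.ιMulti B k M.row)]
  rw [map_sum, map_sum, Finsupp.finsetSum_apply]
  unfold actCoord
  refine Finset.sum_congr rfl fun T _ => ?_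
  rw [map_smul, map_smul, Finsupp.smul_apply, hM, smul_eq_mul]
  congr 1
  rw [exteriorPower.basis_apply, exteriorPower.ιMulti_family, exteriorPower.map_apply_ιMulti, key,
    exteriorPower.ιMultiDual_apply_ιMulti, hc, hc]
  congr 1
  ext a b
  simp [Matrix.single_vecMul]

theorem actCoord_mul (y : KSub n k → B) (g h : Matrix (Fin n) (Fin n) B) :
    actCoord y (g * h) = actCoord (actCoord y g) h := by
  funext S
  unfold actCoord
  have : ∀ S' : KSub n k, ((g * h).submatrix (cols S') (cols S)).det
      = ∑ T : KSub n k,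
        (g.submatrix (cols S') (cols T)).det * (h.submatrix (cols T) (cols S)).det := by
    intro S'
    exact congrFun (minors_mul (g.submatrix (cols S') id) h) S
  simp only [this, Finset.mul_sum, Finset.sum_mul]
  rw [Finset.sum_comm]
  simp only [mul_assoc]

theorem actCoord_one (y : KSub n k → B) : actCoord y 1 = y := by
  classical
  funext S
  unfold actCoord
  rw [Finset.sum_eq_single S]
  · have : (1 : Matrix (Fin n) (Fin n) B).submatrix (cols S) (cols S) = 1 :=
      Matrix.submatrix_one _ (S.1.orderEmbOfFin _).injective
    simp [this]
  · intro T _ hT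
    obtain ⟨i, hi, hi'⟩ := (Set.powersetCard.exists_mem_notMem_iff_ne T S).mp hT
    have : i ∈ Set.range (cols T) := by
      unfold cols
      rw [Finset.range_orderEmbOfFin]; exact hi
    obtain ⟨a, rfl⟩ := this
    rw [Matrix.det_eq_zero_of_row_eq_zero a, mul_zero]
    intro b
    rw [Matrix.submatrix_apply, Matrix.one_apply_ne]
    intro h
    apply hi'
    rw [h]
    exact Finset.orderEmbOfFin_mem S.1 _ b
  · simp

end Pluecker

/-! ### Closed subschemes of the Grassmannian -/

/-- The homogeneous coordinate ring of the projective space that contains `Gr`. -/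
abbrev PRing (K : Type*) [Field K] (n k : ℕ) : Type _ := MvPolynomial (KSub n k) K

/-- The generic `k × n` matrix. -/
noncomputable def genericMatrix (K : Type*) [Field K] (n k : ℕ) :
    Matrix (Fin k) (Fin n) (MvPolynomial (Fin k × Fin n) K) :=
  Matrix.of fun a b => X (a, b)

/-- The forms that vanish on `Gr`. -/
def pluckerForms (K : Type*) [Field K] (n k : ℕ) : Set (PRing K n k) :=
  {f | (∃ d, f.IsHomogeneous d) ∧ aeval (minors (genericMatrix K n k)) f = 0}

/-- A closed subscheme of `Gr`, given by its saturated homogeneous ideal in the Plücker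
coordinates. -/
structure ClosedSubscheme (K : Type*) [Field K] (n k : ℕ) where
  ideal : Ideal (PRing K n k)
  homogeneous : ∀ f ∈ ideal, ∀ d, homogeneousComponent d f ∈ ideal
  saturated : ∀ f, (∀ S, X S * f ∈ ideal) → f ∈ ideal
  plucker : pluckerForms K n k ⊆ ideal

section Saturation

variable {K : Type*} [Field K] {n k : ℕ}

/-- The saturation of an ideal with respect to the irrelevant ideal. -/
def saturation (I : Ideal (PRing K n k)) : Ideal (PRing K n k) where
  carrier := {f | ∃ N : ℕ, ∀ S, X S ^ N * f ∈ I}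
  add_mem' := by
    rintro f g ⟨a, ha⟩ ⟨b, hb⟩
    refine ⟨a + b, fun S => ?_⟩
    have h1 := I.mul_mem_left (X S ^ b) (ha S)
    have h2 := I.mul_mem_left (X S ^ a) (hb S)
    have := I.add_mem h1 h2
    convert this using 1
    ring
  zero_mem' := ⟨0, fun S => by simp⟩
  smul_mem' := by
    rintro c f ⟨a, ha⟩
    refine ⟨a, fun S => ?_⟩
    have := I.mul_mem_left c (ha S)
    convert this using 1
    simp only [smul_eq_mul]
    ring

theorem le_saturation (I : Ideal (PRing K n k)) : I ≤ saturation I :=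
  fun f hf => ⟨0, fun S => by simpa using hf⟩

theorem homogeneousComponent_mul_add {f g : PRing K n k} {d : ℕ} (hg : g.IsHomogeneous d) (e : ℕ) :
    homogeneousComponent (d + e) (g * f) = g * homogeneousComponent e f := by
  conv_lhs => rw [← sum_homogeneousComponent f, Finset.mul_sum, map_sum]
  have : ∀ a, homogeneousComponent (d + e) (g * homogeneousComponent a f)
      = if a = e then g * homogeneousComponent e f else 0 := by
    intro a
    have h := hg.mul (homogeneousComponent_isHomogeneous a f)
    rw [homogeneousComponent_of_mem h]
    by_cases hae : a = e
    · subst hae; simp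
    · rw [if_neg (by omega), if_neg hae]
  simp only [this]
  rw [Finset.sum_ite_eq']
  split_ifs with h
  · rfl
  · rw [homogeneousComponent_eq_zero e f (by simpa using h), mul_zero]

theorem homogeneous_span {s : Set (PRing K n k)} (hs : ∀ f ∈ s, ∃ d, f.IsHomogeneous d)
    {f : PRing K n k} (hf : f ∈ Ideal.span s) (e : ℕ) :
    homogeneousComponent e f ∈ Ideal.span s := by
  induction hf using Submodule.span_induction generalizing e with
  | zero => simp
  | add x y _ _ hx hy => rw [map_add]; exact Ideal.add_mem _ (hx e) (hy e)
  | mem x hx =>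
    obtain ⟨d, hd⟩ := hs x hx
    rw [homogeneousComponent_of_mem hd]
    split_ifs
    · exact Ideal.subset_span hx
    · exact Ideal.zero_mem _
  | smul a x _ hx =>
    rw [smul_eq_mul]
    have ha : a * x = ∑ d ∈ Finset.range (a.totalDegree + 1), homogeneousComponent d a * x := by
      rw [← Finset.sum_mul, sum_homogeneousComponent]
    rw [ha, map_sum]
    refine Ideal.sum_mem _ fun d _ => ?_
    have hd := homogeneousComponent_isHomogeneous d a
    by_cases hde : d ≤ e
    · obtain ⟨c, rfl⟩ := Nat.exists_eq_add_of_le hde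
      rw [homogeneousComponent_mul_add hd]
      exact Ideal.mul_mem_left _ _ (hx c)
    · have hx' : homogeneousComponent d a * x = ∑ c ∈ Finset.range (x.totalDegree + 1),
          homogeneousComponent d a * homogeneousComponent c x := by
        rw [← Finset.mul_sum, sum_homogeneousComponent]
      rw [hx', map_sum]
      refine Ideal.sum_mem _ fun c _ => ?_
      rw [homogeneousComponent_of_mem (hd.mul (homogeneousComponent_isHomogeneous c x)),
        if_neg (by omega)]
      exact Ideal.zero_mem _

/-- The closed subscheme of `Gr` that is cut out by the forms belonging to a set. -/
noncomputable def cutOut (s : Set (PRing K n k)) : ClosedSubscheme K n k where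
  ideal := saturation (Ideal.span ({f ∈ s | ∃ d, f.IsHomogeneous d} ∪ pluckerForms K n k))
  homogeneous := by
    rintro f ⟨N, hN⟩ d
    refine ⟨N, fun S => ?_⟩
    have hX : (X S ^ N : PRing K n k).IsHomogeneous N := isHomogeneous_X_pow S N
    rw [← homogeneousComponent_mul_add hX]
    refine homogeneous_span ?_ (hN S) _
    rintro g (hg | hg)
    · exact hg.2
    · exact hg.1
  saturated := by
    intro f hf
    choose N hN using hf
    refine ⟨(∑ S, N S) + 1, fun S => ?_⟩
    have h : N S ≤ ∑ S, N S := Finset.single_le_sum (fun _ _ => Nat.zero_le _) (Finset.mem_univ S)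
    obtain ⟨c, hc⟩ := Nat.exists_eq_add_of_le h
    have := Ideal.mul_mem_left _ (X S ^ c) (hN S S)
    convert this using 1
    rw [hc]
    ring
  plucker := fun _ hf => le_saturation _ (Ideal.subset_span (Or.inr hf))

end Saturation

namespace ClosedSubscheme

section Basic

variable {K : Type u} [Field K] {n k : ℕ} (Z : ClosedSubscheme K n k)

/-- The points of the subscheme over an algebraic closure of `K`, as subspaces: the row spans of
the `k × n` matrices of rank `k` whose vector of minors is a zero of the ideal. -/
def points : Set (Submodule (AlgebraicClosure K) (Fin n → AlgebraicClosure K)) :=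
  {V | ∃ M : Matrix (Fin k) (Fin n) (AlgebraicClosure K),
    LinearIndependent (AlgebraicClosure K) M.row ∧
    Submodule.span (AlgebraicClosure K) (Set.range M.row) = V ∧
    ∀ f ∈ Z.ideal, aeval (minors M) f = 0}

/-- Invariance under the group scheme of diagonal matrices, on `B`-valued points of the affine
cone for all `K`-algebras `B`. -/
def IsTorusInvariant : Prop :=
  ∀ (B : Type u) [CommRing B] [Algebra K B] (y : KSub n k → B) (t : Fin n → Bˣ),
    (∀ f ∈ Z.ideal, aeval y f = 0) →
    ∀ f ∈ Z.ideal, aeval (actCoord y (Matrix.diagonal fun m => (t m : B))) f = 0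

/-- The underlying space is irreducible (in particular nonempty). -/
def IsIrreducible : Prop := Z.ideal.radical.IsPrime

/-- The subscheme is a variety: irreducible and reduced. -/
def IsVariety : Prop := Z.ideal.IsPrime

/-- The subscheme is defined by the vanishing of a set of Plücker coordinates. -/
def IsDefinedByPluckerCoords : Prop :=
  ∃ A : Set (KSub n k), Z = cutOut (X '' A)

end Basic

/-! ### Geometric shift and sweep -/

section Shift

variable {K : Type*} [Field K] {n k : ℕ} (Z : ClosedSubscheme K n k) (i j : Fin n)

/-- The Plücker coordinates of `x exp (t e_ij) = x (1 + t e_ij)`, as polynomials in those of `x`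
and in the variable `t = X 0`; the variable `X 1` is not used here. -/
noncomputable def expCoord (S : KSub n k) : MvPolynomial (Fin 2) (PRing K n k) :=
  actCoord (fun S' => C (X S')) (Matrix.transvection i j (X 0)) S

/-- The bihomogeneous ideal of the closure, in `ℙ¹ × Gr`, of the family of all
`([t : 1], x exp (t e_ij))` with `t ∈ 𝔸¹` and `x` in the subscheme. The variables `Sum.inl 0` and
`Sum.inl 1` are the homogeneous coordinates on `ℙ¹` and `Sum.inr S` are the Plücker coordinates.
A form vanishes on the closure if and only if it vanishes on the family, that is, at
`((t s, s), x exp (t e_ij))` for generic `t` and `s`. -/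
noncomputable def familyIdeal : Ideal (MvPolynomial (Fin 2 ⊕ KSub n k) K) :=
  (Z.ideal.map (C : PRing K n k →+* MvPolynomial (Fin 2) (PRing K n k))).comap
    (aeval (Sum.elim ![X 0 * X 1, X 1] (expCoord i j)) :
      MvPolynomial (Fin 2 ⊕ KSub n k) K →ₐ[K] MvPolynomial (Fin 2) (PRing K n k))

/-- The geometric shift: the scheme-theoretic fibre of the family over the point
`∞ = [1 : 0]` of `ℙ¹`. -/
noncomputable def shift : ClosedSubscheme K n k :=
  cutOut ((Z.familyIdeal i j).map
    (aeval (Sum.elim ![1, 0] X) : MvPolynomial (Fin 2 ⊕ KSub n k) K →ₐ[K] PRing K n k))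

variable {i j}

theorem rename_mem_familyIdeal {f : PRing K n k} :
    f ∈ (Z.familyIdeal i j).comap (rename Sum.inr : PRing K n k →ₐ[K] _) ↔
      ∀ m, coeff m (aeval (expCoord i j) f : MvPolynomial (Fin 2) (PRing K n k)) ∈ Z.ideal := by
  rw [Ideal.mem_comap, familyIdeal, Ideal.mem_comap, aeval_rename, mem_map_C_iff]
  rfl

/-- All coefficients are forms of degree `d`. -/
def CoeffHom (d : ℕ) (F : MvPolynomial (Fin 2) (PRing K n k)) : Prop :=
  ∀ m, (coeff m F).IsHomogeneous d

theorem CoeffHom.mul {d e : ℕ} {F G : MvPolynomial (Fin 2) (PRing K n k)}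
    (hF : CoeffHom d F) (hG : CoeffHom e G) : CoeffHom (d + e) (F * G) := by
  classical
  intro m
  rw [coeff_mul]
  exact IsHomogeneous.sum _ _ _ fun x _ => (hF _).mul (hG _)

theorem CoeffHom.sum {ι : Type*} {d : ℕ} (s : Finset ι) (F : ι → MvPolynomial (Fin 2) (PRing K n k))
    (hF : ∀ a ∈ s, CoeffHom d (F a)) : CoeffHom d (∑ a ∈ s, F a) := by
  intro m
  rw [coeff_sum]
  exact IsHomogeneous.sum _ _ _ fun x hx => hF x hx m

theorem coeffHom_C {d : ℕ} {f : PRing K n k} (hf : f.IsHomogeneous d) : CoeffHom d (C f) := by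
  classical
  intro m
  rw [coeff_C]
  split_ifs
  · exact hf
  · exact isHomogeneous_zero _ _ _

theorem coeffHom_map (p : MvPolynomial (Fin 2) K) : CoeffHom 0 (map (C : K →+* PRing K n k) p) := by
  intro m
  rw [coeff_map]
  exact isHomogeneous_C _ _

theorem map_transvection_apply {A B : Type*} [CommRing A] [CommRing B] (φ : A →+* B)
    (i j : Fin n) (a : A) (b : B) (h : φ a = b) (p q : Fin n) :
    φ (Matrix.transvection i j a p q) = Matrix.transvection i j b p q := by
  subst h
  simp only [Matrix.transvection, Matrix.add_apply, Matrix.one_apply, Matrix.single_apply, map_add]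
  split_ifs <;> simp

theorem coeffHom_expCoord (S : KSub n k) : CoeffHom 1 (expCoord (K := K) i j S) := by
  refine CoeffHom.sum _ _ fun S' _ => ?_
  refine CoeffHom.mul (e := 0) (coeffHom_C (isHomogeneous_X _ _)) ?_
  have : (Matrix.transvection i j (X 0 : MvPolynomial (Fin 2) (PRing K n k))).submatrix
      (cols S') (cols S) = (map (C : K →+* PRing K n k)).mapMatrix
        ((Matrix.transvection i j (X 0 : MvPolynomial (Fin 2) K)).submatrix (cols S') (cols S)) := by
    ext1 a b
    exact (map_transvection_apply (map (C : K →+* PRing K n k)) i j (X 0) (X 0) (map_X _ _)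
      (cols S' a) (cols S b)).symm
  rw [this, ← RingHom.map_det]
  exact coeffHom_map _

theorem coeffHom_aeval {d : ℕ} {f : PRing K n k} (hf : f.IsHomogeneous d) :
    CoeffHom d (aeval (expCoord i j) f : MvPolynomial (Fin 2) (PRing K n k)) := by
  rw [aeval_def, eval₂_eq]
  refine CoeffHom.sum _ _ fun m hm => ?_
  have hdeg := hf (mem_support_iff.mp hm)
  have hpow : ∀ (S : KSub n k) (a : ℕ), CoeffHom a (expCoord (K := K) i j S ^ a) := by
    intro S a
    induction a with
    | zero => simpa using coeffHom_C (K := K) (n := n) (k := k) (isHomogeneous_one _ _)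
    | succ a ih => rw [pow_succ]; exact ih.mul (coeffHom_expCoord S)
  have hprod : ∀ s : Finset (KSub n k),
      CoeffHom (∑ S ∈ s, m S) (∏ S ∈ s, expCoord (K := K) i j S ^ m S) := by
    classical
    intro s
    induction s using Finset.induction_on with
    | empty => simpa using coeffHom_C (K := K) (n := n) (k := k) (isHomogeneous_one _ _)
    | insert a s ha ih => rw [Finset.prod_insert ha, Finset.sum_insert ha]; exact (hpow _ _).mul ih
  have hd : ∑ S ∈ m.support, m S = d := by
    rw [← hdeg]; simp [Finsupp.weight_apply, Finsupp.sum]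
  have h0 : CoeffHom 0 (algebraMap K (MvPolynomial (Fin 2) (PRing K n k)) (coeff m f)) :=
    coeffHom_C (isHomogeneous_C _ _)
  have := h0.mul (hprod m.support)
  rwa [hd, zero_add] at this

theorem coeff_aeval_homogeneousComponent (f : PRing K n k) (d : ℕ) (m : Fin 2 →₀ ℕ) :
    coeff m (aeval (expCoord i j) (homogeneousComponent d f) : MvPolynomial (Fin 2) (PRing K n k))
      = homogeneousComponent d (coeff m (aeval (expCoord i j) f)) := by
  conv_rhs => rw [← sum_homogeneousComponent f, map_sum, coeff_sum, map_sum]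
  have : ∀ a, homogeneousComponent d (coeff m (aeval (expCoord i j) (homogeneousComponent a f) :
      MvPolynomial (Fin 2) (PRing K n k))) =
      if a = d then coeff m (aeval (expCoord i j) (homogeneousComponent d f)) else 0 := by
    intro a
    rw [homogeneousComponent_of_mem
      (coeffHom_aeval (homogeneousComponent_isHomogeneous a f) m)]
    by_cases h : a = d
    · subst h; simp
    · rw [if_neg (Ne.symm h), if_neg h]
  simp only [this]
  rw [Finset.sum_ite_eq']
  split_ifs with h
  · rfl
  · rw [homogeneousComponent_eq_zero d f (by simpa using h)]; simp

theorem C_X_eq (hij : i ≠ j) (S : KSub n k) :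
    (C (X S) : MvPolynomial (Fin 2) (PRing K n k)) =
      actCoord (B := MvPolynomial (Fin 2) (PRing K n k)) (expCoord i j)
        (Matrix.transvection i j (-X 0)) S := by
  have : (expCoord (K := K) (k := k) i j) = actCoord (B := MvPolynomial (Fin 2) (PRing K n k))
    (fun S' => C (X S')) (Matrix.transvection i j (X 0)) := rfl
  rw [this, ← actCoord_mul, Matrix.transvection_mul_transvection_same _ _ hij, add_neg_cancel,
    Matrix.transvection_zero, actCoord_one]

theorem aeval_minors_eq_zero {B : Type*} [CommRing B] [Algebra K B] (N : Matrix (Fin k) (Fin n) B)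
    {f : PRing K n k} (hf : aeval (minors (genericMatrix K n k)) f = 0) :
    aeval (minors N) f = 0 := by
  have h : (minors N : KSub n k → B) =
      fun S => aeval (fun p : Fin k × Fin n => N p.1 p.2) (minors (genericMatrix K n k) S) := by
    funext S
    unfold minors
    rw [AlgHom.map_det]
    congr 1
    ext a b
    simp [genericMatrix]
  rw [h]
  have := congrArg (aeval (R := K) (fun p : Fin k × Fin n => N p.1 p.2)) hf
  rw [map_zero, ← AlgHom.comp_apply, comp_aeval] at this
  exact this

/-- The geometric sweep: the image of the family under the projection `ℙ¹ × Gr → Gr`, whose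
ideal consists of the functions on the target that vanish on the family. -/
noncomputable def sweep (hij : i ≠ j) : ClosedSubscheme K n k where
  ideal := (Z.familyIdeal i j).comap (rename Sum.inr : PRing K n k →ₐ[K] _)
  homogeneous := by
    intro f hf d
    rw [rename_mem_familyIdeal] at hf ⊢
    intro m
    rw [coeff_aeval_homogeneousComponent]
    exact Z.homogeneous _ (hf m) d
  saturated := by
    intro f hf
    rw [rename_mem_familyIdeal]
    intro m
    refine Z.saturated _ fun S => ?_
    rw [← coeff_C_mul]
    revert m
    rw [← mem_map_C_iff, C_X_eq hij, actCoord, Finset.sum_mul]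
    refine Ideal.sum_mem _ fun S' _ => ?_
    have h := hf S'
    rw [rename_mem_familyIdeal, ← mem_map_C_iff, map_mul, aeval_X] at h
    rw [mul_right_comm]
    exact Ideal.mul_mem_right _ _ h
  plucker := by
    rintro f ⟨⟨d, hd⟩, hf⟩
    rw [SetLike.mem_coe, rename_mem_familyIdeal]
    intro m
    refine Z.plucker ⟨⟨d, coeffHom_aeval hd m⟩, ?_⟩
    let G : Matrix (Fin k) (Fin n) (MvPolynomial (Fin 2) (MvPolynomial (Fin k × Fin n) K)) :=
      (genericMatrix K n k).map (C : _ →+* MvPolynomial (Fin 2) (MvPolynomial (Fin k × Fin n) K))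
    let g : Matrix (Fin n) (Fin n) (MvPolynomial (Fin 2) (MvPolynomial (Fin k × Fin n) K)) :=
      Matrix.transvection i j (X 0)
    let θ : PRing K n k →ₐ[K] MvPolynomial (Fin k × Fin n) K :=
      aeval (minors (genericMatrix K n k))
    have h : aeval (actCoord (minors G) g) f = 0 := by
      rw [← minors_mul]
      exact aeval_minors_eq_zero _ hf
    have key : ((mapAlgHom (σ := Fin 2) θ).comp
        (aeval (expCoord i j) : PRing K n k →ₐ[K] MvPolynomial (Fin 2) (PRing K n k))) =
        aeval (actCoord (minors G) g) := by
      ext1 S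
      simp only [AlgHom.comp_apply, aeval_X, expCoord, actCoord, map_sum, map_mul]
      refine Finset.sum_congr rfl fun S' _ => ?_
      congr 1
      · have h1 : mapAlgHom (σ := Fin 2) θ (C (X S')) = C (minors (genericMatrix K n k) S') := by
          simp [θ]
        rw [h1]
        exact RingHom.map_det _ _
      · rw [AlgHom.map_det]
        congr 1
        ext1 a b
        exact map_transvection_apply (mapAlgHom (σ := Fin 2) θ).toRingHom i j (X 0) (X 0)
          (map_X _ _) _ _
    have e := congrArg (coeff m) (DFunLike.congr_fun key f)
    rw [h, coeff_zero, AlgHom.comp_apply, mapAlgHom_apply, coeff_map] at e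
    exact e

/-- The closure of the family is a variety: its ideal is prime and contains neither of the two
irrelevant ideals. -/
def FamilyIsVariety (i j : Fin n) : Prop :=
  (Z.familyIdeal i j).IsPrime ∧ (∃ a, X (Sum.inl a) ∉ Z.familyIdeal i j) ∧
    ∃ S, X (Sum.inr S) ∉ Z.familyIdeal i j

end Shift

end ClosedSubscheme

/-! ### Function fields and the degree -/

section FunctionField

variable {K τ M : Type*} [Field K] [AddCommMonoid M]

/-- The function field of the (multi)projective variety with prime ideal `P`, where the variables
are graded by `w`: the quotients of forms of the same degree, with denominator not in `P`, inside
the field of fractions of the coordinate ring. -/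
def functionField (w : τ → M) (P : Ideal (MvPolynomial τ K)) [P.IsPrime] :
    Subfield (FractionRing (MvPolynomial τ K ⧸ P)) where
  carrier := {x | ∃ (d : M) (a b : MvPolynomial τ K), a.IsWeightedHomogeneous w d ∧
    b.IsWeightedHomogeneous w d ∧ b ∉ P ∧
    x = algebraMap _ (FractionRing _) (Ideal.Quotient.mk P a) /
      algebraMap _ (FractionRing _) (Ideal.Quotient.mk P b)}
  mul_mem' := by
    rintro _ _ ⟨d, a, b, ha, hb, hbP, rfl⟩ ⟨e, a', b', ha', hb', hbP', rfl⟩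
    refine ⟨d + e, a * a', b * b', ha.mul ha', hb.mul hb', ?_, ?_⟩
    · exact fun h => (Ideal.IsPrime.mem_or_mem ‹_› h).elim hbP hbP'
    · simp only [map_mul]
      rw [div_mul_div_comm]
  one_mem' := ⟨0, 1, 1, isWeightedHomogeneous_one _ _, isWeightedHomogeneous_one _ _,
    fun h => Ideal.IsPrime.ne_top ‹_› ((Ideal.eq_top_iff_one _).mpr h), by simp⟩
  add_mem' := by
    rintro _ _ ⟨d, a, b, ha, hb, hbP, rfl⟩ ⟨e, a', b', ha', hb', hbP', rfl⟩
    refine ⟨d + e, a * b' + b * a', b * b', ?_, hb.mul hb', ?_, ?_⟩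
    · exact (ha.mul hb').add (hb.mul ha')
    · exact fun h => (Ideal.IsPrime.mem_or_mem ‹_› h).elim hbP hbP'
    · have h : ∀ c, c ∉ P →
          algebraMap _ (FractionRing (MvPolynomial τ K ⧸ P)) (Ideal.Quotient.mk P c) ≠ 0 := by
        intro c hc h0
        rw [FaithfulSMul.algebraMap_eq_zero_iff, Ideal.Quotient.eq_zero_iff_mem] at h0
        exact hc h0
      rw [div_add_div _ _ (h b hbP) (h b' hbP')]
      simp only [map_add, map_mul]
  zero_mem' := ⟨0, 0, 1, isWeightedHomogeneous_zero _ _ _, isWeightedHomogeneous_one _ _,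
    fun h => Ideal.IsPrime.ne_top ‹_› ((Ideal.eq_top_iff_one _).mpr h), by simp⟩
  neg_mem' := by
    rintro _ ⟨d, a, b, ha, hb, hbP, rfl⟩
    refine ⟨d, -a, b, ?_, hb, hbP, ?_⟩
    · exact (weightedHomogeneousSubmodule K w d).neg_mem ha
    · simp only [map_neg]
      rw [neg_div]
  inv_mem' := by
    rintro _ ⟨d, a, b, ha, hb, hbP, rfl⟩
    by_cases h : a ∈ P
    · refine ⟨0, 0, 1, isWeightedHomogeneous_zero _ _ _, isWeightedHomogeneous_one _ _,
        fun h => Ideal.IsPrime.ne_top ‹_› ((Ideal.eq_top_iff_one _).mpr h), ?_⟩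
      rw [Ideal.Quotient.eq_zero_iff_mem.mpr h]
      simp
    · exact ⟨d, b, a, hb, ha, h, by rw [inv_div]⟩

end FunctionField

namespace ClosedSubscheme

variable {K : Type*} [Field K] {n k : ℕ} (Z : ClosedSubscheme K n k) {i j : Fin n}

/-- The inclusion of the fraction field of the homogeneous coordinate ring of the sweep into that
of the family, which is induced by the projection `ℙ¹ × Gr → Gr`. It maps the function field of the
sweep into that of the family. -/
noncomputable def sweepPullback (hij : i ≠ j) [(Z.familyIdeal i j).IsPrime]
    [(Z.sweep hij).ideal.IsPrime] :
    FractionRing (PRing K n k ⧸ (Z.sweep hij).ideal) →+*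
      FractionRing (MvPolynomial (Fin 2 ⊕ KSub n k) K ⧸ Z.familyIdeal i j) :=
  IsFractionRing.map (A := PRing K n k ⧸ (Z.sweep hij).ideal)
    (B := MvPolynomial (Fin 2 ⊕ KSub n k) K ⧸ Z.familyIdeal i j)
    (j := Ideal.quotientMap (Z.familyIdeal i j) (rename Sum.inr : PRing K n k →ₐ[K] _).toRingHom
      le_rfl) Ideal.quotientMap_injective

/-- The degree of the projection from the family to the sweep, when both are varieties: the degree
of the function field of the family over the (image of the) function field of the sweep. -/
noncomputable def sweepDegree (hij : i ≠ j) (hQ : Z.FamilyIsVariety i j)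
    (hP : (Z.sweep hij).IsVariety) : ℕ :=
  haveI := hQ.1
  haveI : (Z.sweep hij).ideal.IsPrime := hP
  ((functionField (fun _ => (1 : ℕ)) (Z.sweep hij).ideal).map (Z.sweepPullback hij)).relfinrank
    (functionField (Sum.elim (fun _ => ((1, 0) : ℕ × ℕ)) fun _ => (0, 1)) (Z.familyIdeal i j))

end ClosedSubscheme

end GrassmannShift

/-!
The proof is carried by one observation about weights. Torus invariance makes the ideal of the
subscheme graded by `ℤ ^ n`, where the coordinate `p_S` has the indicator function of `S` as weight
(`weightedHomogeneousComponent_mem`). A power of a single `p_A`, and a product of powers of the two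
coordinates `p_A`, `p_B` that live on a `T`-invariant line, are the only monomials of their degree
and weight (`eq_single_of_weight_eq`, `eq_add_single_of_weight_eq`). Hence `coord A` lies on the
subscheme unless a power of `p_A` is in the ideal, and the line through `coord A` and `coord B` lies
on it unless some `p_A ^ a * p_B ^ b` is in the ideal.

* If the radical is prime, `p_A ^ a * p_B ^ b` cannot be in the ideal without a power of `p_A` or of
  `p_B`; this is `T`-convexity. If the subscheme is cut out by coordinates, `T`-convexity holds
  because the coordinates other than `p_A` and `p_B` vanish on the line.

* The unipotent element `exp (t e_ij)` fixes all Plücker coordinates except those `p_T` with `j ∈ T`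
  and `i ∉ T`, to which it adds `± t p_S`, where `S = T \ j ∪ i`. Points of the shift are
  exhibited as limits of curves: `exp (t e_ij) · coord S` tends to `coord T`, and `coord S` is the
  limit of the translates by `exp (t e_ij)` of points on the line through `coord S` and `coord T`,
  which is on the subscheme by `T`-convexity. The remaining fixed points are excluded by explicit
  elements of the ideal of the family: powers of coordinates, and powers of `s₁ p_T ∓ s₀ p_S`
  (with `t = s₀ / s₁` on `ℙ¹`), which becomes `∓ p_S` at `∞`. See `coordInv_shift`.

* If the ideal is prime and the collection of fixed points is not invariant, then `p_T = 0` and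
  `p_S ≠ 0` on the subscheme for some such pair. So `s₁ p_T = ± s₀ p_S` holds on the family, and the
  coordinate `t = s₀ / s₁` equals the rational function `± p_T / p_S` on the sweep. The function
  field of the family is thus that of the sweep (`functionField_le_map`).
-/

namespace GrassmannShift

open MvPolynomial

/-! ### Diagonal matrices and transvections acting on Plücker coordinates -/

section PlueckerAction

variable {n k : ℕ}

theorem cols_injective (S : KSub n k) : Function.Injective (cols S) :=
  (S.1.orderEmbOfFin _).injective

theorem range_cols (S : KSub n k) : Set.range (cols S) = (S.1 : Set (Fin n)) := by
  unfold cols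
  rw [Finset.range_orderEmbOfFin]

theorem cols_mem (S : KSub n k) (a : Fin k) : cols S a ∈ S.1 :=
  Finset.orderEmbOfFin_mem S.1 _ a

theorem exists_cols_eq {S : KSub n k} {m : Fin n} (hm : m ∈ S.1) : ∃ a, cols S a = m := by
  have : m ∈ Set.range (cols S) := by rw [range_cols]; exact hm
  exact this

theorem KSub.eq_of_subset {S T : KSub n k} (h : S.1 ⊆ T.1) : S = T :=
  Subtype.ext (Finset.eq_of_subset_of_card_le h (by rw [S.2, T.2]))

variable {B : Type*} [CommRing B]

/-- An enumeration `σ` of `T` selects the coordinate at `T`, up to the sign of the permutation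
that sorts `σ`. -/
theorem exists_sign_sum_det (σ : Fin k → Fin n) (hσ : Function.Injective σ) (T : KSub n k)
    (hT : Set.range σ = (T.1 : Set (Fin n))) :
    ∃ ε : ℤˣ, ∀ {B : Type*} [CommRing B] (y : KSub n k → B),
      ∑ S' : KSub n k, y S' * ((1 : Matrix (Fin n) (Fin n) B).submatrix (cols S') σ).det
        = ((ε : ℤ) : B) * y T := by
  classical
  have hr : Set.range σ = Set.range (cols T) := by rw [hT, range_cols]
  let π : Equiv.Perm (Fin k) := (Equiv.ofInjective σ hσ).trans
    ((Equiv.setCongr hr).trans (Equiv.ofInjective _ (cols_injective T)).symm)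
  have hπ : ∀ a, cols T (π a) = σ a := by
    intro a
    simp only [π, Equiv.trans_apply]
    rw [Equiv.apply_ofInjective_symm (cols_injective T)]
    rfl
  refine ⟨Equiv.Perm.sign π, fun {B} _ y => ?_⟩
  rw [Finset.sum_eq_single T]
  · have : (1 : Matrix (Fin n) (Fin n) B).submatrix (cols T) σ
        = (1 : Matrix (Fin k) (Fin k) B).submatrix id π := by
      ext a b
      rw [Matrix.submatrix_apply, Matrix.submatrix_apply, ← hπ b, id, Matrix.one_apply,
        Matrix.one_apply]
      simp [(cols_injective T).eq_iff]
    rw [this, Matrix.det_permute', Matrix.det_one, mul_one, mul_comm]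
  · intro S' _ hS'
    obtain ⟨m, hm, hm'⟩ := (Set.powersetCard.exists_mem_notMem_iff_ne S' T).mp hS'
    obtain ⟨a, rfl⟩ := exists_cols_eq (S := S') hm
    rw [Matrix.det_eq_zero_of_row_eq_zero a, mul_zero]
    intro b
    rw [Matrix.submatrix_apply, Matrix.one_apply_ne]
    intro h
    apply hm'
    have : σ b ∈ Set.range σ := ⟨b, rfl⟩
    rw [hT, ← h] at this
    exact this
  · simp

theorem sum_mul_det_one (y : KSub n k → B) (S : KSub n k) :
    ∑ S' : KSub n k, y S' * ((1 : Matrix (Fin n) (Fin n) B).submatrix (cols S') (cols S)).det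
      = y S :=
  congrFun (actCoord_one y) S

theorem actCoord_diagonal (y : KSub n k → B) (t : Fin n → B) (S : KSub n k) :
    actCoord y (Matrix.diagonal t) S = y S * ∏ a, t (cols S a) := by
  classical
  have h : ∀ S' : KSub n k, ((Matrix.diagonal t).submatrix (cols S') (cols S)).det
      = ((1 : Matrix (Fin n) (Fin n) B).submatrix (cols S') (cols S)).det * ∏ a, t (cols S a) := by
    intro S'
    rw [mul_comm, ← Matrix.det_mul_row]
    congr 1
    ext a b
    simp only [Matrix.submatrix_apply, Matrix.of_apply, Matrix.diagonal_apply, Matrix.one_apply]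
    split_ifs with h
    · rw [h, mul_one]
    · rw [mul_zero]
  unfold actCoord
  simp only [h, ← mul_assoc]
  rw [← Finset.sum_mul, sum_mul_det_one]

/-- The columns of `1 + c e_ij` indexed by a set without `j` are those of the identity. -/
theorem actCoord_transvection_of_notMem (y : KSub n k → B) {i j : Fin n} (c : B) {S : KSub n k}
    (hj : j ∉ S.1) : actCoord y (Matrix.transvection i j c) S = y S := by
  classical
  rw [← sum_mul_det_one y S]
  refine Finset.sum_congr rfl fun S' _ => ?_
  congr 2
  ext a b
  have : cols S b ≠ j := fun h => hj (h ▸ cols_mem S b)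
  simp [Matrix.transvection, this.symm]

/-- Minors of `1 + c e_ij` that use the column of `j`, by linearity in that column: it is the
column of `j` plus `c` times the column of `i` of the identity. -/
theorem actCoord_transvection_of_mem (y : KSub n k → B) {i j : Fin n} (c : B)
    {S : KSub n k} {b : Fin k} (hb : cols S b = j) :
    actCoord y (Matrix.transvection i j c) S = y S + c * ∑ S' : KSub n k, y S' *
      ((1 : Matrix (Fin n) (Fin n) B).submatrix (cols S')
        (Function.update (cols S) b i)).det := by
  classical
  have h : ∀ S' : KSub n k, ((Matrix.transvection i j c).submatrix (cols S') (cols S)).det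
      = ((1 : Matrix (Fin n) (Fin n) B).submatrix (cols S') (cols S)).det
        + c * ((1 : Matrix (Fin n) (Fin n) B).submatrix (cols S')
          (Function.update (cols S) b i)).det := by
    intro S'
    set A := (1 : Matrix (Fin n) (Fin n) B).submatrix (cols S') (cols S) with hA
    have h1 : (1 : Matrix (Fin n) (Fin n) B).submatrix (cols S') (Function.update (cols S) b i)
        = A.updateCol b (fun a => (1 : Matrix (Fin n) (Fin n) B) (cols S' a) i) := by
      ext a d
      by_cases hd : d = b
      · subst hd
        rw [Matrix.submatrix_apply, Matrix.updateCol_self, Function.update_self]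
      · rw [Matrix.submatrix_apply, Matrix.updateCol_ne hd, Function.update_of_ne hd]
        rfl
    have h2 : (Matrix.transvection i j c).submatrix (cols S') (cols S)
        = A.updateCol b ((fun a => A a b) +
          c • (fun a => (1 : Matrix (Fin n) (Fin n) B) (cols S' a) i)) := by
      ext a d
      by_cases hd : d = b
      · subst hd
        simp [hA, Matrix.transvection, Matrix.single_apply, hb, Matrix.one_apply, eq_comm]
      · have : cols S d ≠ j := fun h => hd (cols_injective S (h.trans hb.symm))
        simp [hd, hA, Matrix.transvection, this.symm]
    rw [h1, h2, Matrix.det_updateCol_add, Matrix.det_updateCol_smul]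
    congr 2
    exact Matrix.updateCol_eq_self A b
  unfold actCoord
  simp only [h, mul_add, Finset.sum_add_distrib]
  rw [sum_mul_det_one, Finset.mul_sum]
  congr 1
  refine Finset.sum_congr rfl fun _ _ => ?_
  ring

theorem actCoord_transvection_of_mem_of_mem (y : KSub n k → B) {i j : Fin n} (hij : i ≠ j) (c : B)
    {S : KSub n k} (hi : i ∈ S.1) : actCoord y (Matrix.transvection i j c) S = y S := by
  classical
  by_cases hj : j ∈ S.1
  · obtain ⟨a, ha⟩ := exists_cols_eq hi
    obtain ⟨b, hb⟩ := exists_cols_eq hj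
    have hab : a ≠ b := by rintro rfl; exact hij (ha.symm.trans hb)
    rw [actCoord_transvection_of_mem y c hb, Finset.sum_eq_zero, mul_zero, add_zero]
    intro S' _
    rw [Matrix.det_zero_of_column_eq hab, mul_zero]
    intro r
    rw [Matrix.submatrix_apply, Matrix.submatrix_apply, Function.update_self,
      Function.update_of_ne hab, ha]
  · exact actCoord_transvection_of_notMem y c hj

/-- Replacing `i` by `j` in a set that contains `i` but not `j`. -/
def replace (i j : Fin n) (S : KSub n k) (hi : i ∈ S.1) (hj : j ∉ S.1) : KSub n k :=
  ⟨insert j (S.1.erase i), by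
    have h : j ∉ S.1.erase i := fun h => hj (Finset.mem_of_mem_erase h)
    have hk : S.1.card = k := S.2
    have := Finset.card_pos.mpr ⟨i, hi⟩
    rw [Set.powersetCard.mem_iff, Finset.card_insert_of_notMem h, Finset.card_erase_of_mem hi]
    omega⟩

/-- If `j ∈ T` and `i ∉ T`, then `1 + c e_ij` adds to the coordinate at `T` the multiple `± c` of
the coordinate at `T \ j ∪ i`. The sign depends neither on the ring nor on `c`. -/
theorem exists_actCoord_transvection {i j : Fin n} {T U : KSub n k} (hj : j ∈ T.1) (hi : i ∉ T.1)
    (hU : U = replace j i T hj hi) :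
    ∃ ε : ℤˣ, ∀ {B : Type*} [CommRing B] (y : KSub n k → B) (c : B),
      actCoord y (Matrix.transvection i j c) T = y T + ((ε : ℤ) : B) * c * y U := by
  classical
  subst hU
  obtain ⟨b, hb⟩ := exists_cols_eq hj
  have hinj : Function.Injective (Function.update (cols T) b i) := by
    intro p q hpq
    simp only [Function.update_apply] at hpq
    split_ifs at hpq with h1 h2 h2
    · rw [h1, h2]
    · exact absurd (hpq ▸ cols_mem T q) hi
    · exact absurd (hpq ▸ cols_mem T p) hi
    · exact cols_injective T hpq
  have hrange : Set.range (Function.update (cols T) b i) =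
      ((replace j i T hj hi).1 : Set (Fin n)) := by
    ext m
    simp only [replace, Finset.coe_insert, Finset.coe_erase, Set.mem_range, Set.mem_insert_iff,
      Set.mem_sdiff, Finset.mem_coe, Set.mem_singleton_iff, Function.update_apply]
    constructor
    · rintro ⟨a, rfl⟩
      split_ifs with h
      · exact Or.inl rfl
      · refine Or.inr ⟨cols_mem T a, fun h' => h (cols_injective T (h'.trans hb.symm))⟩
    · rintro (rfl | ⟨hm, hmj⟩)
      · exact ⟨b, if_pos rfl⟩
      · obtain ⟨a, rfl⟩ := exists_cols_eq hm
        refine ⟨a, if_neg ?_⟩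
        rintro rfl
        exact hmj hb
  obtain ⟨ε, hε⟩ := exists_sign_sum_det _ hinj _ hrange
  refine ⟨ε, fun {B} _ y c => ?_⟩
  rw [actCoord_transvection_of_mem y c hb, hε]
  ring

end PlueckerAction

/-! ### Monomials that are alone in their degree and torus weight -/

section Weights

variable {n k : ℕ}

/-- The character by which the torus acts on the Plücker coordinate at `S`: the indicator function
of `S`. -/
def torusWeight (S : KSub n k) : Fin n → ℤ := ∑ a, Pi.single (cols S a) 1

theorem torusWeight_apply (S : KSub n k) (m : Fin n) :
    torusWeight S m = if m ∈ S.1 then 1 else 0 := by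
  classical
  unfold torusWeight
  rw [Finset.sum_apply]
  split_ifs with h
  · obtain ⟨a, rfl⟩ := exists_cols_eq h
    rw [Finset.sum_eq_single a]
    · simp
    · intro b _ hb
      rw [Pi.single_apply, if_neg fun h => hb (cols_injective S h).symm]
    · simp
  · refine Finset.sum_eq_zero fun a _ => ?_
    rw [Pi.single_apply, if_neg]
    rintro rfl
    exact h (cols_mem S a)

theorem weight_torusWeight_apply (ν : KSub n k →₀ ℕ) (m : Fin n) :
    Finsupp.weight torusWeight ν m = ∑ S, if m ∈ S.1 then (ν S : ℤ) else 0 := by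
  rw [Finsupp.weight_eq_sum, Finset.sum_apply]
  refine Finset.sum_congr rfl fun S _ => ?_
  rw [Pi.smul_apply, torusWeight_apply]
  split_ifs <;> simp

/-- The only `k`-element sets between `M` and `M ∪ {a, b}` are the two fixed points of a line. -/
theorem KSub.eq_or_eq_of_between {M : Finset (Fin n)} {a b : Fin n} (ha : a ∉ M) {A B S : KSub n k}
    (hA : A.1 = insert a M) (hB : B.1 = insert b M) (h1 : M ⊆ S.1)
    (h2 : S.1 ⊆ insert a (insert b M)) : S = A ∨ S = B := by
  have hex : ∃ m ∈ S.1, m ∉ M := by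
    by_contra! hcon
    have := Finset.card_le_card (show S.1 ⊆ M from hcon)
    have h3 : (insert a M).card = k := by rw [← hA]; exact A.2
    rw [Set.powersetCard.card_eq, ← h3, Finset.card_insert_of_notMem ha] at this
    omega
  obtain ⟨m, hm, hmM⟩ := hex
  rcases Finset.mem_insert.mp (h2 hm) with rfl | hm'
  · refine Or.inl (KSub.eq_of_subset ?_).symm
    rw [hA]
    exact Finset.insert_subset hm h1
  · rcases Finset.mem_insert.mp hm' with rfl | hm''
    · refine Or.inr (KSub.eq_of_subset ?_).symm
      rw [hB]
      exact Finset.insert_subset hm h1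
    · exact absurd hm'' hmM

/-- If the sets indexing one monomial all lie between two given sets, then so do those indexing
any other monomial of the same degree and weight: the weight at `m` counts the factors whose set
contains `m`, so it vanishes if `m` is outside `hi`, and equals the degree if `m` is in `lo`. -/
theorem between_of_weight_eq {μ ν : KSub n k →₀ ℕ} (hdeg : ν.degree = μ.degree)
    (hwt : Finsupp.weight torusWeight ν = Finsupp.weight torusWeight μ) {lo hi : Finset (Fin n)}
    (hμ : ∀ S ∈ μ.support, lo ⊆ S.1 ∧ S.1 ⊆ hi) :
    ∀ S ∈ ν.support, lo ⊆ S.1 ∧ S.1 ⊆ hi := by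
  have hw : ∀ m, (∑ S : KSub n k, if m ∈ S.1 then (ν S : ℤ) else 0)
      = ∑ S : KSub n k, if m ∈ S.1 then (μ S : ℤ) else 0 := by
    intro m
    rw [← weight_torusWeight_apply, hwt, weight_torusWeight_apply]
  have hd : (∑ S, (ν S : ℤ)) = ∑ S, (μ S : ℤ) := by
    have := congrArg (Nat.cast : ℕ → ℤ) hdeg
    simpa only [Finsupp.degree_eq_sum, Nat.cast_sum] using this
  intro S hS
  rw [Finsupp.mem_support_iff] at hS
  refine ⟨fun m hm => ?_, fun m hm => ?_⟩
  · by_contra hmS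
    have h : (∑ S : KSub n k, ((ν S : ℤ) - if m ∈ S.1 then (ν S : ℤ) else 0)) = 0 := by
      rw [Finset.sum_sub_distrib, hd, hw, ← Finset.sum_sub_distrib]
      refine Finset.sum_eq_zero fun U _ => ?_
      by_cases hU : U ∈ μ.support
      · rw [if_pos ((hμ U hU).1 hm), sub_self]
      · rw [Finsupp.notMem_support_iff.mp hU]; simp
    rw [Finset.sum_eq_zero_iff_of_nonneg] at h
    · have := h S (Finset.mem_univ _)
      rw [if_neg hmS] at this
      omega
    · intro U _
      split_ifs <;> simp
  · by_contra hmh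
    have h : (∑ S : KSub n k, if m ∈ S.1 then (ν S : ℤ) else 0) = 0 := by
      rw [hw]
      refine Finset.sum_eq_zero fun U _ => ?_
      split_ifs with hmU
      · by_cases hU : U ∈ μ.support
        · exact absurd ((hμ U hU).2 hmU) hmh
        · rw [Finsupp.notMem_support_iff.mp hU]; simp
      · rfl
    rw [Finset.sum_eq_zero_iff_of_nonneg] at h
    · have := h S (Finset.mem_univ _)
      rw [if_pos hm] at this
      omega
    · intro U _
      split_ifs <;> simp

/-- A power of one Plücker coordinate is the only monomial of its degree and weight. -/
theorem eq_single_of_weight_eq {A : KSub n k} {p : ℕ} {ν : KSub n k →₀ ℕ}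
    (hdeg : ν.degree = (Finsupp.single A p).degree)
    (hwt : Finsupp.weight torusWeight ν = Finsupp.weight torusWeight (Finsupp.single A p)) :
    ν = Finsupp.single A p := by
  classical
  have h := between_of_weight_eq hdeg hwt (lo := ∅) (hi := A.1) (by
    intro S hS
    have : S = A := by simpa using Finsupp.support_single_subset hS
    subst this
    simp)
  have h0 : ∀ S, S ≠ A → ν S = 0 := by
    intro S hS
    by_contra hne
    exact hS (KSub.eq_of_subset (h S (Finsupp.mem_support_iff.mpr hne)).2)
  have hν : ν = Finsupp.single A (ν A) := by
    ext S
    by_cases hS : S = A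
    · subst hS; simp
    · rw [h0 S hS, Finsupp.single_eq_of_ne hS]
  rw [hν, Finsupp.degree_single, Finsupp.degree_single] at hdeg
  rw [hν, hdeg]

/-- A monomial in the two Plücker coordinates that do not vanish identically on a `T`-invariant
line is the only monomial of its degree and weight: a set lying between `M` and `M ∪ {a, b}` is one
of the two fixed points, and the weight at `a` then determines the exponents. -/
theorem eq_add_single_of_weight_eq {M : Finset (Fin n)} {a b : Fin n} (hab : a ≠ b) (ha : a ∉ M)
    {A B : KSub n k} (hA : A.1 = insert a M) (hB : B.1 = insert b M) {p q : ℕ}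
    {ν : KSub n k →₀ ℕ}
    (hdeg : ν.degree = (Finsupp.single A p + Finsupp.single B q).degree)
    (hwt : Finsupp.weight torusWeight ν =
      Finsupp.weight torusWeight (Finsupp.single A p + Finsupp.single B q)) :
    ν = Finsupp.single A p + Finsupp.single B q := by
  classical
  have hne : A ≠ B := by
    rintro rfl
    have : a ∈ insert b M := by rw [← hB, hA]; exact Finset.mem_insert_self _ _
    simp [hab, ha] at this
  have h := between_of_weight_eq hdeg hwt (lo := M) (hi := insert a (insert b M)) (by
    intro S hS
    have hS' : S = A ∨ S = B := by
      rcases Finset.mem_union.mp (Finsupp.support_add hS) with h | h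
      · exact Or.inl (by simpa using Finsupp.support_single_subset h)
      · exact Or.inr (by simpa using Finsupp.support_single_subset h)
    rcases hS' with rfl | rfl
    · rw [hA]
      exact ⟨Finset.subset_insert _ _, Finset.insert_subset_insert _ (Finset.subset_insert _ _)⟩
    · rw [hB]
      exact ⟨Finset.subset_insert _ _, Finset.subset_insert _ _⟩)
  have h0 : ∀ S, S ≠ A → S ≠ B → ν S = 0 := by
    intro S hSA hSB
    by_contra hne
    obtain ⟨h1, h2⟩ := h S (Finsupp.mem_support_iff.mpr hne)
    exact (KSub.eq_or_eq_of_between ha hA hB h1 h2).elim hSA hSB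
  have hν : ν = Finsupp.single A (ν A) + Finsupp.single B (ν B) := by
    ext S
    by_cases hSA : S = A
    · subst hSA; simp [hne]
    · by_cases hSB : S = B
      · subst hSB; simp [hSA]
      · rw [h0 S hSA hSB, Finsupp.add_apply, Finsupp.single_eq_of_ne hSA,
          Finsupp.single_eq_of_ne hSB, add_zero]
  have haA : a ∈ A.1 := by rw [hA]; exact Finset.mem_insert_self _ _
  have haB : a ∉ B.1 := by rw [hB]; simp [hab, ha]
  have hwa := congrFun hwt a
  rw [hν] at hwa hdeg
  simp only [map_add, Finsupp.weight_single, Pi.add_apply, Pi.smul_apply, torusWeight_apply,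
    if_pos haA, if_neg haB, Finsupp.degree_single] at hwa hdeg
  simp at hwa
  rw [hν, hwa, show ν B = q by omega]

end Weights

/-! ### Ideals of torus-invariant subschemes -/

section Invariant

variable {K : Type u} [Field K] {n k : ℕ} (Z : ClosedSubscheme K n k)

/-- Translation by `g`, as a unit of the group algebra. -/
noncomputable def groupAlgebraUnit (A : Type*) [CommRing A] {G : Type*} [AddCommGroup G] (g : G) :
    (AddMonoidAlgebra A G)ˣ where
  val := AddMonoidAlgebra.single g 1
  inv := AddMonoidAlgebra.single (-g) 1
  val_inv := by rw [AddMonoidAlgebra.single_mul_single, add_neg_cancel, one_mul]; rfl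
  inv_val := by rw [AddMonoidAlgebra.single_mul_single, neg_add_cancel, one_mul]; rfl

/-- The coefficient at `g` of the coaction of a torus on a polynomial is its part of weight `g`. -/
theorem coeff_aeval_single {σ A G : Type*} [CommRing A] [Algebra K A] [AddCommGroup G]
    (w : σ → G) (φ : MvPolynomial σ K →ₐ[K] A) (f : MvPolynomial σ K) (g : G) :
    (aeval (fun s => (AddMonoidAlgebra.single (w s) (φ (X s)) : AddMonoidAlgebra A G)) f).coeff g
      = φ (weightedHomogeneousComponent w g f) := by
  classical
  have hexp : aeval (fun s => (AddMonoidAlgebra.single (w s) (φ (X s)) : AddMonoidAlgebra A G)) f =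
      ∑ ν ∈ f.support, (AddMonoidAlgebra.single (Finsupp.weight w ν)
        (φ (monomial ν (coeff ν f))) : AddMonoidAlgebra A G) := by
    conv_lhs => rw [f.as_sum, map_sum]
    refine Finset.sum_congr rfl fun ν _ => ?_
    rw [aeval_monomial]
    simp only [AddMonoidAlgebra.single_pow]
    rw [AddMonoidAlgebra.finsuppProd_single, AddMonoidAlgebra.coe_algebraMap, Function.comp_apply,
      AddMonoidAlgebra.single_mul_single, zero_add]
    congr 1
    rw [monomial_eq, map_mul, Finsupp.prod, Finsupp.prod, map_prod, ← algebraMap_eq,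
      AlgHom.commutes]
    simp only [map_pow]
  rw [hexp, weightedHomogeneousComponent_apply, map_sum, Finset.sum_filter,
    AddMonoidAlgebra.coeff_sum, Finsupp.finsetSum_apply]
  refine Finset.sum_congr rfl fun ν _ => ?_
  rw [AddMonoidAlgebra.coeff_single, Finsupp.single_apply]

theorem actCoord_groupAlgebraUnit {A : Type*} [CommRing A] (x : KSub n k → A) :
    actCoord (fun S => (AddMonoidAlgebra.single 0 (x S) : AddMonoidAlgebra A (Fin n → ℤ)))
      (Matrix.diagonal fun m => (groupAlgebraUnit A (Pi.single m (1 : ℤ))).val) =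
      fun S => AddMonoidAlgebra.single (torusWeight S) (x S) := by
  funext S
  rw [actCoord_diagonal]
  simp only [groupAlgebraUnit]
  rw [AddMonoidAlgebra.prod_single, AddMonoidAlgebra.single_mul_single, zero_add,
    Finset.prod_const_one, mul_one]
  rfl

theorem aeval_single_zero {σ A G : Type*} [CommRing A] [Algebra K A] [AddCommGroup G]
    (φ : MvPolynomial σ K →ₐ[K] A) (f : MvPolynomial σ K) :
    aeval (fun s => (AddMonoidAlgebra.single 0 (φ (X s)) : AddMonoidAlgebra A G)) f
      = AddMonoidAlgebra.single 0 (φ f) := by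
  have h : aeval (fun s => (AddMonoidAlgebra.single 0 (φ (X s)) : AddMonoidAlgebra A G)) =
      (AddMonoidAlgebra.singleZeroAlgHom : A →ₐ[K] AddMonoidAlgebra A G).comp φ := by
    ext1 s
    rw [aeval_X]
    rfl
  rw [h]
  rfl

/-- The ideal of a torus-invariant subscheme is graded by the torus weights: apply the invariance
to the generic point of the torus acting on the generic point of the cone over the subscheme. -/
theorem weightedHomogeneousComponent_mem (hT : Z.IsTorusInvariant) {f : PRing K n k}
    (hf : f ∈ Z.ideal) (g : Fin n → ℤ) :
    weightedHomogeneousComponent torusWeight g f ∈ Z.ideal := by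
  obtain ⟨A, _, _, φ, hφ⟩ : ∃ (A : Type u) (_ : CommRing A) (_ : Algebra K A)
      (φ : PRing K n k →ₐ[K] A), ∀ f, φ f = 0 ↔ f ∈ Z.ideal :=
    ⟨PRing K n k ⧸ Z.ideal, inferInstance, inferInstance, Ideal.Quotient.mkₐ K Z.ideal,
      fun f => Ideal.Quotient.eq_zero_iff_mem⟩
  have h := hT (AddMonoidAlgebra A (Fin n → ℤ)) (fun S => AddMonoidAlgebra.single 0 (φ (X S)))
    (fun m => groupAlgebraUnit A (Pi.single m (1 : ℤ)))
    (fun f hf => by rw [aeval_single_zero, (hφ f).mpr hf, AddMonoidAlgebra.single_zero]) f hf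
  rw [actCoord_groupAlgebraUnit] at h
  rw [← hφ, ← coeff_aeval_single, h]
  rfl

/-- If a monomial is alone in its degree and weight and occurs in an element of the ideal, then it
belongs to the ideal. -/
theorem monomial_mem_of_coeff_ne_zero (hT : Z.IsTorusInvariant) {f : PRing K n k}
    (hf : f ∈ Z.ideal) {μ : KSub n k →₀ ℕ} (hμ : coeff μ f ≠ 0)
    (huniq : ∀ ν : KSub n k →₀ ℕ, ν.degree = μ.degree →
      Finsupp.weight torusWeight ν = Finsupp.weight torusWeight μ → ν = μ) :
    monomial μ 1 ∈ Z.ideal := by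
  classical
  have h := weightedHomogeneousComponent_mem Z hT (Z.homogeneous f hf μ.degree)
    (Finsupp.weight torusWeight μ)
  have he : weightedHomogeneousComponent torusWeight (Finsupp.weight torusWeight μ)
      (homogeneousComponent μ.degree f) = C (coeff μ f) * monomial μ 1 := by
    ext ν
    rw [coeff_weightedHomogeneousComponent, coeff_homogeneousComponent, coeff_C_mul,
      coeff_monomial]
    by_cases hν : μ = ν
    · subst hν; simp
    · rw [if_neg hν, mul_zero]
      split_ifs with h1 h2
      · exact absurd (huniq ν h2 h1).symm hν
      · rfl
      · rfl
  rw [he] at h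
  have := Z.ideal.mul_mem_left (C (coeff μ f)⁻¹) h
  rwa [← mul_assoc, ← C_mul, inv_mul_cancel₀ hμ, C_1, one_mul] at this

theorem aeval_eq_zero_of_forall_support {E σ : Type*} [CommRing E] [Algebra K E] (y : σ → E)
    (f : MvPolynomial σ K) (h : ∀ ν ∈ f.support, ∃ S ∈ ν.support, y S = 0) : aeval y f = 0 := by
  rw [aeval_def, eval₂_eq]
  refine Finset.sum_eq_zero fun ν hν => ?_
  obtain ⟨S, hS, hyS⟩ := h ν hν
  rw [Finset.prod_eq_zero hS, mul_zero]
  rw [hyS, zero_pow (Finsupp.mem_support_iff.mp hS)]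

/-- The points over `E` of the affine cone over a subscheme. -/
def cone (E : Type*) [CommRing E] [Algebra K E] : Set (KSub n k → E) :=
  {y | ∀ f ∈ Z.ideal, aeval y f = 0}

/-- Scaling the variables by a character of the grading scales a form by the value of the
character at its degree. -/
theorem aeval_mul_of_isWeightedHomogeneous {E σ M : Type*} [CommRing E] [Algebra K E]
    [AddCommMonoid M] {w : σ → M} {d : M} {f : MvPolynomial σ K} (hf : f.IsWeightedHomogeneous w d)
    (χ : Multiplicative M →* E) (y : σ → E) :
    aeval (fun s => χ (Multiplicative.ofAdd (w s)) * y s) f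
      = χ (Multiplicative.ofAdd d) * aeval y f := by
  rw [aeval_def, eval₂_eq, aeval_def, eval₂_eq, Finset.mul_sum]
  refine Finset.sum_congr rfl fun ν hν => ?_
  have hd := hf (mem_support_iff.mp hν)
  have : χ (Multiplicative.ofAdd d) = ∏ s ∈ ν.support, χ (Multiplicative.ofAdd (w s)) ^ ν s := by
    rw [← hd, Finsupp.weight_apply, Finsupp.sum, ofAdd_sum, map_prod]
    simp only [ofAdd_nsmul, map_pow]
  simp only [mul_pow]
  rw [Finset.prod_mul_distrib, this]
  ring

variable {Z}

theorem smul_mem_cone {E : Type*} [CommRing E] [Algebra K E] {y : KSub n k → E}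
    (hy : y ∈ cone Z E) (c : E) : c • y ∈ cone Z E := by
  intro f hf
  rw [← sum_homogeneousComponent f, map_sum]
  refine Finset.sum_eq_zero fun d _ => ?_
  have h := aeval_mul_of_isWeightedHomogeneous (K := K)
    (homogeneousComponent_isHomogeneous d f) (powersHom E c) y
  rw [hy _ (Z.homogeneous f hf d), mul_zero] at h
  rw [← h]
  congr 1
  congr 1
  funext S
  simp

theorem single_mem_cone_iff (hT : Z.IsTorusInvariant) {E : Type*} [Field E] [Algebra K E]
    [DecidableEq (KSub n k)] (S : KSub n k) :
    (Pi.single S 1 : KSub n k → E) ∈ cone Z E ↔ ∀ p : ℕ, (X S : PRing K n k) ^ p ∉ Z.ideal := by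
  constructor
  · intro h p hp
    have := h _ hp
    simp at this
  · intro h f hf
    refine aeval_eq_zero_of_forall_support _ _ fun ν hν => ?_
    by_contra! hcon
    have hsupp : ν = Finsupp.single S (ν S) := by
      ext U
      by_cases hU : U = S
      · subst hU; simp
      · rw [Finsupp.single_eq_of_ne hU]
        by_contra hne
        exact hcon U (Finsupp.mem_support_iff.mpr hne) (Pi.single_eq_of_ne hU _)
    refine h (ν S) ?_
    rw [X_pow_eq_monomial]
    rw [hsupp] at hν
    exact monomial_mem_of_coeff_ne_zero Z hT hf (mem_support_iff.mp hν)
      fun ν' => eq_single_of_weight_eq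

/-- For a torus-invariant subscheme, only a product of powers of the two Plücker coordinates on a
`T`-invariant line can keep that line from lying on the subscheme. -/
theorem mem_cone_of_line (hT : Z.IsTorusInvariant) {E : Type*} [Field E] [Algebra K E]
    {M : Finset (Fin n)} {a b : Fin n} (hab : a ≠ b) (ha : a ∉ M)
    {A B : KSub n k} (hA : A.1 = insert a M) (hB : B.1 = insert b M)
    (h : ∀ p q : ℕ, (X A : PRing K n k) ^ p * X B ^ q ∉ Z.ideal) {y : KSub n k → E}
    (hy : ∀ S, S ≠ A → S ≠ B → y S = 0) : y ∈ cone Z E := by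
  classical
  have hne : A ≠ B := by
    rintro rfl
    have : a ∈ insert b M := by rw [← hB, hA]; exact Finset.mem_insert_self _ _
    simp [hab, ha] at this
  intro f hf
  refine aeval_eq_zero_of_forall_support _ _ fun ν hν => ?_
  by_contra! hcon
  have hsupp : ν = Finsupp.single A (ν A) + Finsupp.single B (ν B) := by
    ext S
    by_cases hSA : S = A
    · subst hSA; simp [hne]
    · by_cases hSB : S = B
      · subst hSB; simp [hSA]
      · rw [Finsupp.add_apply, Finsupp.single_eq_of_ne hSA, Finsupp.single_eq_of_ne hSB]
        by_contra hne'
        exact hcon S (Finsupp.mem_support_iff.mpr hne') (hy S hSA hSB)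
  refine h (ν A) (ν B) ?_
  rw [X_pow_eq_monomial, X_pow_eq_monomial, monomial_mul, one_mul]
  rw [hsupp] at hν
  exact monomial_mem_of_coeff_ne_zero Z hT hf (mem_support_iff.mp hν)
    fun ν' => eq_add_single_of_weight_eq hab ha hA hB

end Invariant

/-! ### Coordinate subspaces -/

section Coord

variable {F : Type*} [Field F] {n k : ℕ}

theorem single_mem_coord {S : Finset (Fin n)} {m : Fin n} (hm : m ∈ S) (c : F) :
    (Pi.single m c : Fin n → F) ∈ coord F S := by
  intro m' hm'
  rw [Pi.single_eq_of_ne]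
  rintro rfl
  exact hm' hm

theorem coord_le_iff {S : Finset (Fin n)} {V : Submodule F (Fin n → F)} :
    coord F S ≤ V ↔ ∀ m ∈ S, (Pi.single m 1 : Fin n → F) ∈ V := by
  classical
  refine ⟨fun h m hm => h (single_mem_coord hm 1), fun h v hv => ?_⟩
  rw [pi_eq_sum_univ' v]
  refine V.sum_mem fun m _ => ?_
  by_cases hm : m ∈ S
  · exact V.smul_mem _ (h m hm)
  · rw [hv m hm, zero_smul]
    exact V.zero_mem

theorem coord_le_coord_iff {S T : Finset (Fin n)} : coord F S ≤ coord F T ↔ S ⊆ T := by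
  rw [coord_le_iff]
  refine ⟨fun h m hm => ?_, fun h m hm => single_mem_coord (h hm) 1⟩
  by_contra hmT
  have := h m hm m hmT
  simp at this

theorem coord_lt_coord_iff {S T : Finset (Fin n)} : coord F S < coord F T ↔ S ⊂ T := by
  rw [lt_iff_le_not_ge, coord_le_coord_iff, coord_le_coord_iff]
  rfl

/-- The coordinate subspaces are fixed by the torus. -/
theorem coord_mem_torusFixed_iff {Y : Set (Submodule F (Fin n → F))} {S : Finset (Fin n)} :
    coord F S ∈ torusFixed Y ↔ coord F S ∈ Y := by
  refine ⟨fun h => h.1, fun h => ⟨h, fun t => ?_⟩⟩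
  refine le_antisymm ?_ ?_
  · rw [Submodule.map_le_iff_le_comap]
    intro v hv m hm
    simp [Matrix.vecMul_diagonal, hv m hm]
  · intro v hv
    refine ⟨fun m => v m * (t m)⁻¹, fun m hm => by simp [hv m hm], ?_⟩
    funext m
    simp [Matrix.vecMul_diagonal]

theorem coordInv_torusFixed (Y : Set (Submodule F (Fin n → F))) :
    coordInv k (torusFixed Y) = coordInv k Y := by
  ext S
  exact and_congr_right fun _ => coord_mem_torusFixed_iff

end Coord

/-! ### Row spans and their minors -/

section Minors

variable {F : Type*} [Field F] {n k : ℕ}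

theorem linearIndependent_row_of_minors_ne_zero {N : Matrix (Fin k) (Fin n) F} {S : KSub n k}
    (h : minors N S ≠ 0) : LinearIndependent F N.row := by
  have h' := Matrix.linearIndependent_rows_of_det_ne_zero h
  exact LinearIndependent.of_comp (LinearMap.funLeft F F (cols S)) h'

/-- The exterior product of linearly independent rows is nonzero, and its coordinates are the
minors. -/
theorem exists_minors_ne_zero {N : Matrix (Fin k) (Fin n) F} (h : LinearIndependent F N.row) :
    ∃ S : KSub n k, minors N S ≠ 0 := by
  by_contra! hcon
  have hne := (exteriorPower.ιMulti_family_linearIndependent_field (n := k) h).ne_zero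
    (Set.powersetCard.ofFinEmbEquiv (RelEmbedding.refl _))
  apply hne
  apply ((Pi.basisFun F (Fin n)).exteriorPower k).repr.injective
  rw [map_zero]
  ext S
  rw [exteriorPower.ιMulti_family, Equiv.symm_apply_apply, exteriorPower.basis_repr_apply,
    exteriorPower.ιMultiDual_apply_ιMulti]
  exact hcon S

theorem minors_mul_left {B : Type*} [CommRing B] (P : Matrix (Fin k) (Fin k) B)
    (N : Matrix (Fin k) (Fin n) B) : minors (P * N) = P.det • minors N := by
  funext S
  rw [Pi.smul_apply, smul_eq_mul, minors, minors, ← Matrix.det_mul]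
  rfl

/-- If a row span contains the basis vector at `m`, then a combination of the rows vanishes on
each set of columns without `m`. -/
theorem minors_eq_zero_of_coord_le {N : Matrix (Fin k) (Fin n) F} {M : Finset (Fin n)}
    (hM : coord F M ≤ Submodule.span F (Set.range N.row)) {S : KSub n k} (hS : ¬ M ⊆ S.1) :
    minors N S = 0 := by
  classical
  by_contra hne
  obtain ⟨m, hm, hmS⟩ := Finset.not_subset.mp hS
  obtain ⟨c, hc⟩ := (Submodule.mem_span_range_iff_exists_fun F).mp (coord_le_iff.mp hM m hm)
  have h0 : Matrix.vecMul c (N.submatrix id (cols S)) = 0 := by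
    funext b
    have := congrFun hc (cols S b)
    rw [Pi.single_eq_of_ne (by rintro rfl; exact hmS (cols_mem S b))] at this
    rw [Pi.zero_apply, ← this, Finset.sum_apply]
    rfl
  have hc0 := Matrix.eq_zero_of_vecMul_eq_zero hne h0
  have := congrFun hc m
  simp [hc0] at this

theorem minors_eq_zero_of_le_coord {N : Matrix (Fin k) (Fin n) F} {U : Finset (Fin n)}
    (hU : Submodule.span F (Set.range N.row) ≤ coord F U) {S : KSub n k} (hS : ¬ S.1 ⊆ U) :
    minors N S = 0 := by
  obtain ⟨m, hm, hmU⟩ := Finset.not_subset.mp hS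
  obtain ⟨b, rfl⟩ := exists_cols_eq hm
  refine Matrix.det_eq_zero_of_column_eq_zero b fun a => ?_
  exact hU (Submodule.subset_span ⟨a, rfl⟩) _ hmU

theorem exists_row_span {V : Submodule F (Fin n → F)} (hV : Module.finrank F V = k) :
    ∃ N : Matrix (Fin k) (Fin n) F, LinearIndependent F N.row ∧
      Submodule.span F (Set.range N.row) = V := by
  let b := Module.finBasisOfFinrankEq F V hV
  refine ⟨Matrix.of fun r => (b r : Fin n → F), ?_, ?_⟩
  · exact b.linearIndependent.map' V.subtype V.ker_subtype
  · have : Set.range (Matrix.of fun r => (b r : Fin n → F)).row = V.subtype '' Set.range b := by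
      rw [← Set.range_comp]
      rfl
    rw [this, Submodule.span_image, b.span_eq, Submodule.map_top, Submodule.range_subtype]

/-- The `k × n` matrix whose rows are the standard basis vectors indexed by `S`. -/
def coordRows (B : Type*) [CommRing B] (S : KSub n k) : Matrix (Fin k) (Fin n) B :=
  (1 : Matrix (Fin n) (Fin n) B).submatrix (cols S) id

theorem minors_coordRows (B : Type*) [CommRing B] [DecidableEq (KSub n k)] (S : KSub n k) :
    minors (coordRows B S) = Pi.single S 1 := by
  funext T
  have h := sum_mul_det_one (Pi.single S (1 : B)) T
  rw [← h, Finset.sum_eq_single S]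
  · rw [Pi.single_eq_same, one_mul]
    rfl
  · intro U _ hU
    rw [Pi.single_eq_of_ne hU, zero_mul]
  · simp

theorem coordRows_row (S : KSub n k) (a : Fin k) :
    (coordRows F S).row a = Pi.single (cols S a) 1 := by
  funext m
  simp [coordRows, Matrix.row, Matrix.one_apply, Pi.single_apply, eq_comm]

theorem linearIndependent_coordRows (S : KSub n k) :
    LinearIndependent F (coordRows F S).row := by
  classical
  refine linearIndependent_row_of_minors_ne_zero (S := S) ?_
  rw [minors_coordRows, Pi.single_eq_same]
  exact one_ne_zero

theorem span_coordRows (S : KSub n k) :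
    Submodule.span F (Set.range (coordRows F S).row) = coord F S.1 := by
  refine le_antisymm ?_ ?_
  · rw [Submodule.span_le]
    rintro _ ⟨a, rfl⟩
    rw [coordRows_row]
    exact single_mem_coord (cols_mem S a) 1
  · rw [coord_le_iff]
    intro m hm
    obtain ⟨a, rfl⟩ := exists_cols_eq hm
    rw [← coordRows_row]
    exact Submodule.subset_span ⟨a, rfl⟩

theorem finrank_coord (S : KSub n k) : Module.finrank F (coord F S.1) = k := by
  rw [← span_coordRows, finrank_span_eq_card (linearIndependent_coordRows S), Fintype.card_fin]

end Minors

/-! ### Torus-invariant lines -/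

section Line

variable {F : Type*} [Field F] {n k : ℕ} {M : Finset (Fin n)} {a b : Fin n} {A B : KSub n k}

theorem line_comm : line F k M a b = line F k M b a := by
  unfold line
  rw [Finset.insert_comm]

theorem coord_mem_line (hab : a ≠ b) (ha : a ∉ M) (hb : b ∉ M) (hA : A.1 = insert a M) :
    coord F A.1 ∈ line F k M a b := by
  refine ⟨finrank_coord A, ?_, ?_⟩
  · rw [coord_lt_coord_iff, hA]
    exact Finset.ssubset_insert ha
  · rw [coord_lt_coord_iff, hA, Finset.insert_comm]
    exact Finset.ssubset_insert (by simp [hab.symm, hb])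

theorem eq_coord_of_single_mem {V : Submodule F (Fin n → F)} (hV : V ∈ line F k M a b)
    (hA : A.1 = insert a M) (h : (Pi.single a 1 : Fin n → F) ∈ V) : V = coord F A.1 := by
  refine (Submodule.eq_of_le_of_finrank_eq ?_ ?_).symm
  · rw [coord_le_iff, hA]
    intro m hm
    rcases Finset.mem_insert.mp hm with rfl | hm
    · exact h
    · exact coord_le_iff.mp hV.2.1.le m hm
  · rw [finrank_coord, hV.1]

/-- Over an infinite field, a `T`-invariant line has no `T`-fixed points besides the two coordinate
subspaces on it. -/
theorem eq_coord_of_mem_torusFixed_line [Infinite F] (hab : a ≠ b) (hA : A.1 = insert a M)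
    (hB : B.1 = insert b M) {V : Submodule F (Fin n → F)} (hV : V ∈ torusFixed (line F k M a b)) :
    V = coord F A.1 ∨ V = coord F B.1 := by
  classical
  obtain ⟨hVl, hfix⟩ := hV
  obtain ⟨v, hvV, hvM⟩ := SetLike.exists_of_lt hVl.2.1
  -- The part of `v` outside `M` is a combination of the basis vectors at `a` and `b`.
  set w : Fin n → F := fun m => if m ∈ M then 0 else v m with hw
  have hwV : w ∈ V := by
    have : w = v - fun m => if m ∈ M then v m else 0 := by
      funext m
      simp only [hw, Pi.sub_apply]
      split_ifs <;> simp
    rw [this]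
    refine V.sub_mem hvV (hVl.2.1.le fun m hm => ?_)
    rw [if_neg hm]
  have hw0 : ∀ m, m ≠ a → m ≠ b → w m = 0 := by
    intro m hma hmb
    simp only [hw]
    split_ifs with h
    · rfl
    · exact hVl.2.2.le hvV m (by simp [hma, hmb, h])
  by_cases hwa : w a = 0
  · right
    refine eq_coord_of_single_mem (a := b) (b := a) (by rwa [line_comm]) hB ?_
    have hwb : w b ≠ 0 := by
      intro hwb
      refine hvM fun m hm => ?_
      have : w m = v m := if_neg hm
      rw [← this]
      by_cases hma : m = a
      · rw [hma, hwa]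
      · by_cases hmb : m = b
        · rw [hmb, hwb]
        · exact hw0 m hma hmb
    have : (Pi.single b 1 : Fin n → F) = (w b)⁻¹ • w := by
      funext m
      by_cases hmb : m = b
      · subst hmb; simp [hwb]
      · rw [Pi.single_eq_of_ne hmb, Pi.smul_apply]
        by_cases hma : m = a
        · rw [hma, hwa, smul_zero]
        · rw [hw0 m hma hmb, smul_zero]
    rw [this]
    exact V.smul_mem _ hwV
  · left
    refine eq_coord_of_single_mem hVl hA ?_
    obtain ⟨c, hc⟩ := Infinite.exists_notMem_finset ({0, 1} : Finset F)
    simp only [Finset.mem_insert, Finset.mem_singleton, not_or] at hc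
    have hc1 : c - 1 ≠ 0 := sub_ne_zero.mpr hc.2
    let t : Fin n → Fˣ := Function.update 1 a (Units.mk0 c hc.1)
    have htw : Matrix.vecMulLinear (Matrix.diagonal fun m => (t m : F)) w ∈ V := by
      have := Submodule.mem_map_of_mem
        (f := Matrix.vecMulLinear (Matrix.diagonal fun m => (t m : F))) hwV
      rwa [hfix t] at this
    have : (Pi.single a 1 : Fin n → F) = ((c - 1) * w a)⁻¹ •
        (Matrix.vecMulLinear (Matrix.diagonal fun m => (t m : F)) w - w) := by
      funext m
      rw [Pi.smul_apply, Pi.sub_apply, Matrix.vecMulLinear_apply, Matrix.vecMul_diagonal]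
      by_cases hma : m = a
      · subst hma
        simp only [t, Pi.single_eq_same, Function.update_self, Units.val_mk0, smul_eq_mul]
        field_simp
      · rw [Pi.single_eq_of_ne hma]
        simp [t, hma]
    rw [this]
    exact V.smul_mem _ (V.sub_mem htw hwV)

/-- The translates of the fixed point `coord A` by the root subgroup of all `1 + c e_ab` stay on the
line. -/
theorem span_coordRows_mul_transvection_mem_line (hab : a ≠ b) (ha : a ∉ M) (hb : b ∉ M)
    (hA : A.1 = insert a M) (c : F) :
    LinearIndependent F (coordRows F A * Matrix.transvection a b c).row ∧
      Submodule.span F (Set.range (coordRows F A * Matrix.transvection a b c).row)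
        ∈ line F k M a b := by
  classical
  have haA : a ∈ A.1 := by rw [hA]; exact Finset.mem_insert_self _ _
  obtain ⟨r₀, hr₀⟩ := exists_cols_eq haA
  have hli : LinearIndependent F (coordRows F A * Matrix.transvection a b c).row := by
    refine linearIndependent_row_of_minors_ne_zero (S := A) ?_
    rw [minors_mul, actCoord_transvection_of_mem_of_mem _ hab _ haA, minors_coordRows,
      Pi.single_eq_same]
    exact one_ne_zero
  have hrow : ∀ r, (coordRows F A * Matrix.transvection a b c).row r =
      Pi.single (cols A r) 1 + if cols A r = a then Pi.single b c else 0 := by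
    intro r
    funext m
    change (coordRows F A * Matrix.transvection a b c) r m = _
    rw [Matrix.transvection, Matrix.mul_add, Matrix.mul_one, Matrix.add_apply]
    have h1 := congrFun (coordRows_row (F := F) A r) m
    rw [Matrix.row] at h1
    rw [h1, Pi.add_apply]
    congr 1
    by_cases hm : m = b
    · subst hm
      rw [Matrix.mul_single_apply_same]
      have h2 := congrFun (coordRows_row (F := F) A r) a
      rw [Matrix.row] at h2
      rw [h2, Pi.single_apply]
      by_cases hra : cols A r = a
      · rw [if_pos hra, if_pos hra.symm]; simp
      · rw [if_neg hra, if_neg (Ne.symm hra)]; simp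
    · rw [Matrix.mul_single_apply_of_ne _ _ _ _ _ hm]
      split_ifs <;> simp [hm]
  refine ⟨hli, ?_, ?_, ?_⟩
  · rw [finrank_span_eq_card hli, Fintype.card_fin]
  · refine lt_of_le_not_ge ?_ fun hle => ?_
    · rw [coord_le_iff]
      intro m hm
      obtain ⟨r, hr⟩ := exists_cols_eq (S := A) (m := m)
        (by rw [hA]; exact Finset.mem_insert_of_mem hm)
      refine Submodule.subset_span ⟨r, ?_⟩
      rw [hrow, hr, if_neg (by rintro rfl; exact ha hm), add_zero]
    · have := hle (Submodule.subset_span ⟨r₀, rfl⟩) a ha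
      rw [hrow, hr₀] at this
      simp [hab] at this
  · refine lt_of_le_not_ge ?_ fun hle => ?_
    · rw [Submodule.span_le]
      rintro _ ⟨r, rfl⟩
      rw [hrow]
      refine Submodule.add_mem _ (single_mem_coord ?_ 1) ?_
      · rw [Finset.insert_comm]
        exact Finset.mem_insert_of_mem (hA ▸ cols_mem A r)
      · split_ifs
        · exact single_mem_coord (by simp) c
        · exact Submodule.zero_mem _
    · have hker : Submodule.span F (Set.range (coordRows F A * Matrix.transvection a b c).row) ≤
          LinearMap.ker (LinearMap.proj (R := F) (φ := fun _ : Fin n => F) b -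
            c • LinearMap.proj (R := F) (φ := fun _ : Fin n => F) a) := by
        rw [Submodule.span_le]
        rintro _ ⟨r, rfl⟩
        have hbr : b ≠ cols A r := by
          intro h
          have := cols_mem A r
          rw [← h, hA] at this
          simp [hab.symm, hb] at this
        rw [SetLike.mem_coe, LinearMap.mem_ker, hrow]
        by_cases hra : cols A r = a
        · simp [hra, hab, hab.symm]
        · simp [hra, hbr, Ne.symm hra]
      have := hker (hle (single_mem_coord (m := b) (by simp) 1))
      simp [hab] at this

end Line

/-! ### Points of subschemes and `T`-convexity -/

section Points

variable {K : Type u} [Field K] {n k : ℕ} {Z : ClosedSubscheme K n k}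

/-- Membership of a row span in the subscheme can be tested on any matrix with that row span: the
vectors of minors of two such matrices are proportional. -/
theorem minors_mem_cone {N : Matrix (Fin k) (Fin n) (AlgebraicClosure K)}
    (h : Submodule.span (AlgebraicClosure K) (Set.range N.row) ∈ Z.points) :
    minors N ∈ cone Z (AlgebraicClosure K) := by
  obtain ⟨M, -, hspan, hM⟩ := h
  have hex : ∀ r, ∃ c : Fin k → AlgebraicClosure K, ∑ s, c s • M.row s = N.row r := by
    intro r
    rw [← Submodule.mem_span_range_iff_exists_fun, hspan]
    exact Submodule.subset_span ⟨r, rfl⟩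
  choose P hP using hex
  have hN : N = Matrix.of P * M := by
    ext r m
    have := congrFun (hP r) m
    rw [Finset.sum_apply] at this
    exact this.symm
  rw [hN, minors_mul_left]
  exact smul_mem_cone hM _

theorem coord_mem_points_iff [DecidableEq (KSub n k)] (S : KSub n k) :
    coord (AlgebraicClosure K) S.1 ∈ Z.points ↔
      (Pi.single S 1 : KSub n k → AlgebraicClosure K) ∈ cone Z (AlgebraicClosure K) := by
  rw [← minors_coordRows, ← span_coordRows]
  exact ⟨minors_mem_cone, fun h => ⟨_, linearIndependent_coordRows S, rfl, h⟩⟩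

theorem coord_mem_points_iff_forall_pow (hT : Z.IsTorusInvariant) (S : KSub n k) :
    coord (AlgebraicClosure K) S.1 ∈ Z.points ↔ ∀ p : ℕ, (X S : PRing K n k) ^ p ∉ Z.ideal := by
  classical
  rw [coord_mem_points_iff, single_mem_cone_iff hT]

theorem coord_notMem_points_of_pow_mem {S : KSub n k} {p : ℕ}
    (h : (X S : PRing K n k) ^ p ∈ Z.ideal) : coord (AlgebraicClosure K) S.1 ∉ Z.points := by
  classical
  rw [coord_mem_points_iff]
  intro hS
  have := hS _ h
  simp at this

/-- On a `T`-invariant line all Plücker coordinates but two vanish, so only such vectors of minors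
need to be tested. -/
theorem mem_points_of_line {M : Finset (Fin n)} {a b : Fin n} (ha : a ∉ M) {A B : KSub n k}
    (hA : A.1 = insert a M) (hB : B.1 = insert b M)
    (h : ∀ N : Matrix (Fin k) (Fin n) (AlgebraicClosure K),
      LinearIndependent (AlgebraicClosure K) N.row →
      (∀ S, S ≠ A → S ≠ B → minors N S = 0) → minors N ∈ cone Z (AlgebraicClosure K)) :
    line (AlgebraicClosure K) k M a b ⊆ Z.points := by
  intro V hV
  obtain ⟨N, hN, rfl⟩ := exists_row_span hV.1
  refine ⟨N, hN, rfl, h N hN fun S hSA hSB => ?_⟩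
  by_cases h1 : M ⊆ S.1
  · by_cases h2 : S.1 ⊆ insert a (insert b M)
    · exfalso
      exact (KSub.eq_or_eq_of_between ha hA hB h1 h2).elim hSA hSB
    · exact minors_eq_zero_of_le_coord hV.2.2.le h2
  · exact minors_eq_zero_of_coord_le hV.2.1.le h1

/-- To check `T`-convexity, it suffices to consider the two coordinate subspaces on each line. -/
theorem tConvex_of_forall
    (h : ∀ (M : Finset (Fin n)) (a b : Fin n) (A B : KSub n k), a ∉ M → b ∉ M → a ≠ b →
      A.1 = insert a M → B.1 = insert b M →
      coord (AlgebraicClosure K) A.1 ∈ Z.points → coord (AlgebraicClosure K) B.1 ∈ Z.points →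
      line (AlgebraicClosure K) k M a b ⊆ Z.points) : TConvex k Z.points := by
  intro M a b hcard ha hb hab hfix
  let A : KSub n k := ⟨insert a M, by
    rw [Set.powersetCard.mem_iff, Finset.card_insert_of_notMem ha, hcard]⟩
  let B : KSub n k := ⟨insert b M, by
    rw [Set.powersetCard.mem_iff, Finset.card_insert_of_notMem hb, hcard]⟩
  refine h M a b A B ha hb hab rfl rfl (hfix ?_) (hfix ?_)
  · exact coord_mem_torusFixed_iff.mpr (coord_mem_line hab ha hb rfl)
  · rw [line_comm]
    exact coord_mem_torusFixed_iff.mpr (coord_mem_line hab.symm hb ha rfl)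

/-- If neither fixed point of a line is excluded by a power of its coordinate, then primality of
the radical prevents a product of such powers from excluding the line. -/
theorem tConvex_of_isIrreducible (hT : Z.IsTorusInvariant) (hZ : Z.IsIrreducible) :
    TConvex k Z.points := by
  refine tConvex_of_forall fun M a b A B ha hb hab hA hB hAZ hBZ => ?_
  rw [coord_mem_points_iff_forall_pow hT] at hAZ hBZ
  refine mem_points_of_line ha hA hB fun N _ hN =>
    mem_cone_of_line hT hab ha hA hB (fun p q hpq => ?_) hN
  have hP : Z.ideal.radical.IsPrime := hZ
  rcases hP.mem_or_mem (Ideal.le_radical hpq) with h | h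
  · obtain ⟨m, hm⟩ := hP.mem_of_pow_mem _ h
    exact hAZ m hm
  · obtain ⟨m, hm⟩ := hP.mem_of_pow_mem _ h
    exact hBZ m hm

theorem mem_cone_cutOut {s : Set (PRing K n k)} {E : Type*} [Field E] [Algebra K E]
    {N : Matrix (Fin k) (Fin n) E} (hN : LinearIndependent E N.row)
    (h : ∀ f ∈ s, (∃ d, f.IsHomogeneous d) → aeval (minors N) f = 0) :
    minors N ∈ cone (cutOut s) E := by
  rintro f ⟨m, hm⟩
  obtain ⟨S, hS⟩ := exists_minors_ne_zero hN
  have hle : Ideal.span ({f ∈ s | ∃ d, f.IsHomogeneous d} ∪ pluckerForms K n k) ≤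
      RingHom.ker (aeval (R := K) (minors N)) := by
    rw [Ideal.span_le]
    rintro g (hg | hg)
    · exact h g hg.1 hg.2
    · exact ClosedSubscheme.aeval_minors_eq_zero N hg.2
  have := hle (hm S)
  rw [RingHom.mem_ker, map_mul, map_pow, aeval_X] at this
  exact (mul_eq_zero.mp this).resolve_left (pow_ne_zero _ hS)

theorem mem_cutOut_ideal {s : Set (PRing K n k)} {f : PRing K n k} (hf : f ∈ s) {d : ℕ}
    (hd : f.IsHomogeneous d) : f ∈ (cutOut s).ideal :=
  le_saturation _ (Ideal.subset_span (Or.inl ⟨hf, d, hd⟩))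

/-- On a `T`-invariant line all Plücker coordinates but two vanish, and those two do not vanish at
the respective fixed points. -/
theorem tConvex_of_isDefinedByPluckerCoords (hZ : Z.IsDefinedByPluckerCoords) :
    TConvex k Z.points := by
  obtain ⟨s, rfl⟩ := hZ
  refine tConvex_of_forall fun M a b A B ha hb hab hA hB hAZ hBZ => ?_
  refine mem_points_of_line ha hA hB fun N hli hN => mem_cone_cutOut hli ?_
  rintro _ ⟨S, hS, rfl⟩ -
  rw [aeval_X]
  have hX : ∀ T : KSub n k, T ∈ s → coord (AlgebraicClosure K) T.1 ∉ (cutOut (X '' s)).points :=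
    fun T hT => coord_notMem_points_of_pow_mem (p := 1)
      (by rw [pow_one]; exact mem_cutOut_ideal ⟨T, hT, rfl⟩ (isHomogeneous_X _ _))
  refine hN S ?_ ?_
  · rintro rfl
    exact hX _ hS hAZ
  · rintro rfl
    exact hX _ hS hBZ

/-- `T`-convexity puts each translate of a fixed point along a `T`-invariant line on the
subscheme. -/
theorem actCoord_single_mem_cone_of_tConvex [DecidableEq (KSub n k)] (hc : TConvex k Z.points)
    {M : Finset (Fin n)} {a b : Fin n} (ha : a ∉ M) (hb : b ∉ M) (hab : a ≠ b) {A B : KSub n k}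
    (hA : A.1 = insert a M) (hB : B.1 = insert b M)
    (hAZ : coord (AlgebraicClosure K) A.1 ∈ Z.points)
    (hBZ : coord (AlgebraicClosure K) B.1 ∈ Z.points) (c : AlgebraicClosure K) :
    actCoord (Pi.single A 1) (Matrix.transvection a b c) ∈ cone Z (AlgebraicClosure K) := by
  have hcard : M.card + 1 = k := by
    rw [← Finset.card_insert_of_notMem ha, ← hA, Set.powersetCard.card_eq]
  have hl : line (AlgebraicClosure K) k M a b ⊆ Z.points := by
    refine hc M a b hcard ha hb hab fun V hV => ?_
    rcases eq_coord_of_mem_torusFixed_line hab hA hB hV with rfl | rfl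
    · exact hAZ
    · exact hBZ
  rw [← minors_coordRows, ← minors_mul]
  exact minors_mem_cone (hl (span_coordRows_mul_transvection_mem_line hab ha hb hA c).2)

end Points

/-! ### Combinatorial shifts and transvections -/

section Replace

variable {n k : ℕ} {i j : Fin n}

theorem shiftSet_eq (hij : i ≠ j) (S : Finset (Fin n)) :
    shiftSet i j S = if i ∈ S ∧ j ∉ S then insert j (S.erase i) else S := by
  unfold shiftSet shiftElt
  ext m
  simp only [Finset.mem_image]
  split_ifs with h
  · rw [Finset.mem_insert, Finset.mem_erase]
    constructor
    · rintro ⟨a, ha, rfl⟩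
      by_cases hai : a = i
      · subst hai; simp [h.2]
      · simp [hai, ha]
    · rintro (rfl | ⟨hmi, hm⟩)
      · exact ⟨i, h.1, by simp [h.2]⟩
      · exact ⟨m, hm, by simp [hmi]⟩
  · constructor
    · rintro ⟨a, ha, rfl⟩
      by_cases hai : a = i
      · subst hai
        have : j ∈ S := by by_contra hj; exact h ⟨ha, hj⟩
        simp [ha, this]
      · simp [hai, ha]
    · intro hm
      refine ⟨m, hm, ?_⟩
      by_cases hmi : m = i
      · subst hmi
        have : j ∈ S := by by_contra hj; exact h ⟨hm, hj⟩
        simp [this]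
      · simp [hmi]

theorem mem_replace {S : KSub n k} (hi : i ∈ S.1) (hj : j ∉ S.1) :
    j ∈ (replace i j S hi hj).1 := Finset.mem_insert_self _ _

theorem notMem_replace (hij : i ≠ j) {S : KSub n k} (hi : i ∈ S.1) (hj : j ∉ S.1) :
    i ∉ (replace i j S hi hj).1 := by
  simp [replace, hij]

theorem replace_replace (hij : i ≠ j) {S : KSub n k} (hi : i ∈ S.1) (hj : j ∉ S.1) :
    replace j i (replace i j S hi hj) (mem_replace hi hj) (notMem_replace hij hi hj) = S := by
  apply Subtype.ext
  change insert i ((insert j (S.1.erase i)).erase j) = S.1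
  rw [Finset.erase_insert (fun h => hj (Finset.mem_of_mem_erase h)), Finset.insert_erase hi]

theorem shiftSet_replace (hij : i ≠ j) {S : KSub n k} (hi : i ∈ S.1) (hj : j ∉ S.1) :
    shiftSet i j S.1 = (replace i j S hi hj).1 := by
  rw [shiftSet_eq hij, if_pos ⟨hi, hj⟩]
  rfl

variable {B : Type*} [CommRing B]

theorem actCoord_smul (c : B) (y : KSub n k → B) (g : Matrix (Fin n) (Fin n) B) :
    actCoord (c • y) g = c • actCoord y g := by
  funext S
  simp only [actCoord, Pi.smul_apply, smul_eq_mul, Finset.mul_sum, mul_assoc]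

theorem actCoord_single_of_fixed [DecidableEq (KSub n k)] (hij : i ≠ j) {S : KSub n k}
    (hS : ¬ (i ∈ S.1 ∧ j ∉ S.1)) (c : B) :
    actCoord (Pi.single S 1) (Matrix.transvection i j c) = Pi.single S 1 := by
  funext U
  by_cases hj : j ∈ U.1
  · by_cases hi : i ∈ U.1
    · rw [actCoord_transvection_of_mem_of_mem _ hij _ hi]
    · obtain ⟨ε, hε⟩ := exists_actCoord_transvection hj hi rfl
      rw [hε, Pi.single_eq_of_ne (i := S) (i' := replace j i U hj hi), mul_zero, add_zero]
      rintro rfl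
      exact hS ⟨mem_replace hj hi, notMem_replace hij.symm hj hi⟩
  · rw [actCoord_transvection_of_notMem _ _ hj]

theorem exists_actCoord_single [DecidableEq (KSub n k)] (hij : i ≠ j) {S : KSub n k}
    (hi : i ∈ S.1) (hj : j ∉ S.1) :
    ∃ ε : ℤˣ, ∀ {B : Type*} [CommRing B] (c : B),
      actCoord (Pi.single S 1) (Matrix.transvection i j c) =
        Pi.single S 1 + Pi.single (replace i j S hi hj) (((ε : ℤ) : B) * c) := by
  obtain ⟨ε, hε⟩ := exists_actCoord_transvection (mem_replace hi hj) (notMem_replace hij hi hj)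
    (replace_replace hij hi hj).symm
  refine ⟨ε, fun {B} _ c => ?_⟩
  funext U
  by_cases hU : U = replace i j S hi hj
  · subst hU
    rw [hε, Pi.add_apply, Pi.single_eq_same, Pi.single_eq_same, mul_one]
  · rw [Pi.add_apply, Pi.single_eq_of_ne hU, add_zero]
    by_cases hjU : j ∈ U.1
    · by_cases hiU : i ∈ U.1
      · rw [actCoord_transvection_of_mem_of_mem _ hij _ hiU]
      · obtain ⟨ε', hε'⟩ := exists_actCoord_transvection hjU hiU rfl
        rw [hε', Pi.single_eq_of_ne (i := S) (i' := replace j i U hjU hiU), mul_zero, add_zero]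
        rintro rfl
        exact hU (replace_replace hij.symm hjU hiU).symm
    · rw [actCoord_transvection_of_notMem _ _ hjU]

end Replace

/-! ### Fixed points of the geometric shift -/

section Family

variable {K : Type u} [Field K] {n k : ℕ} {Z : ClosedSubscheme K n k} {i j : Fin n}

theorem mem_familyIdeal {f : MvPolynomial (Fin 2 ⊕ KSub n k) K} :
    f ∈ Z.familyIdeal i j ↔
      aeval (Sum.elim ![X 0 * X 1, X 1] (ClosedSubscheme.expCoord i j)) f ∈
        Z.ideal.map (C : PRing K n k →+* MvPolynomial (Fin 2) (PRing K n k)) :=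
  Iff.rfl

theorem expCoord_of_fixed (hij : i ≠ j) {S : KSub n k} (hS : ¬ (j ∈ S.1 ∧ i ∉ S.1)) :
    ClosedSubscheme.expCoord (K := K) i j S = C (X S) := by
  by_cases hj : j ∈ S.1
  · have hi : i ∈ S.1 := by by_contra hi; exact hS ⟨hj, hi⟩
    exact actCoord_transvection_of_mem_of_mem _ hij _ hi
  · exact actCoord_transvection_of_notMem _ _ hj

theorem exists_expCoord {T U : KSub n k} (hj : j ∈ T.1) (hi : i ∉ T.1)
    (hU : U = replace j i T hj hi) :
    ∃ ε : ℤˣ, ClosedSubscheme.expCoord (K := K) i j T =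
      C (X T) + ((ε : ℤ) : MvPolynomial (Fin 2) (PRing K n k)) * X 0 * C (X U) := by
  obtain ⟨ε, hε⟩ := exists_actCoord_transvection hj hi hU
  exact ⟨ε, hε _ _⟩

/-- The equation `s₁ p_T = ± s₀ p_S`, where `T = S \ i ∪ j`, holds on the family up to a multiple
of the coordinate at `T` of the original point. -/
theorem exists_aeval_relation (hij : i ≠ j) {S : KSub n k} (hi : i ∈ S.1) (hj : j ∉ S.1) :
    ∃ ε : ℤˣ, aeval (Sum.elim ![X 0 * X 1, X 1] (ClosedSubscheme.expCoord (K := K) i j))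
      (X (Sum.inl 1) * X (Sum.inr (replace i j S hi hj)) -
        ((ε : ℤ) : MvPolynomial (Fin 2 ⊕ KSub n k) K) * (X (Sum.inl 0) * X (Sum.inr S))) =
      X 1 * C (X (replace i j S hi hj)) := by
  obtain ⟨ε, hε⟩ := exists_expCoord (K := K) (mem_replace hi hj) (notMem_replace hij hi hj)
    (replace_replace hij hi hj).symm
  refine ⟨ε, ?_⟩
  simp only [map_sub, map_mul, aeval_X, Sum.elim_inl, Sum.elim_inr, Matrix.cons_val_zero,
    Matrix.cons_val_one, map_intCast, hε, expCoord_of_fixed hij fun h => hj h.1]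
  ring

/-- The elements of the ideal of the family vanish at `((t s, s), x exp (t e_ij))` for `x` in the
cone over the subscheme. -/
theorem aeval_familyIdeal {E : Type*} [CommRing E] [Algebra K E] {y : KSub n k → E}
    (hy : y ∈ cone Z E) {f : MvPolynomial (Fin 2 ⊕ KSub n k) K} (hf : f ∈ Z.familyIdeal i j)
    (t s : E) :
    aeval (Sum.elim ![t * s, s] (actCoord y (Matrix.transvection i j t))) f = 0 := by
  let ψ : MvPolynomial (Fin 2) (PRing K n k) →ₐ[K] E := aevalTower (aeval y) ![t, s]
  have hle : Z.ideal.map (C : PRing K n k →+* MvPolynomial (Fin 2) (PRing K n k)) ≤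
      RingHom.ker ψ := by
    rw [Ideal.map_le_iff_le_comap]
    intro g hg
    rw [Ideal.mem_comap, RingHom.mem_ker]
    exact (aevalTower_C _ _ g).trans (hy g hg)
  have h := hle (mem_familyIdeal.mp hf)
  rw [RingHom.mem_ker, ← AlgHom.comp_apply, comp_aeval] at h
  rw [← h]
  congr 2
  funext v
  rcases v with a | S
  · fin_cases a <;> simp [ψ]
  · simp only [Sum.elim_inr, ClosedSubscheme.expCoord, actCoord, map_sum, map_mul]
    refine Finset.sum_congr rfl fun S' _ => ?_
    congr 1
    · simp [ψ]
    · rw [AlgHom.map_det]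
      congr 1
      ext1 a b
      exact (ClosedSubscheme.map_transvection_apply ψ.toRingHom i j (X 0) t
        (by simp [ψ]) _ _).symm

/-- A polynomial equation that holds along a punctured curve holds at the puncture. -/
theorem aeval_eval_zero_of_forall_ne {E σ : Type*} [Field E] [Infinite E] [Algebra K E]
    (f : MvPolynomial σ K) (q : σ → Polynomial E)
    (h : ∀ s : E, s ≠ 0 → aeval (fun v => (q v).eval s) f = 0) :
    aeval (fun v => (q v).eval 0) f = 0 := by
  have heval : ∀ s : E, (aeval q f).eval s = aeval (fun v => (q v).eval s) f := by
    intro s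
    have := DFunLike.congr_fun (comp_aeval (R := K) q
      ((Polynomial.aeval s : Polynomial E →ₐ[E] E).restrictScalars K)) f
    simpa [Polynomial.coe_aeval_eq_eval] using this
  have hzero : aeval q f = 0 := by
    refine Polynomial.eq_zero_of_infinite_isRoot _ (Set.Infinite.mono (s := {0}ᶜ) ?_ ?_)
    · intro s hs
      change (aeval q f).eval s = 0
      rw [heval, h s hs]
    · exact (Set.finite_singleton (0 : E)).infinite_compl
  rw [← heval, hzero, Polynomial.eval_zero]

theorem coord_mem_shift_points [DecidableEq (KSub n k)] {S : KSub n k}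
    (h : ∀ f ∈ Z.familyIdeal i j,
      aeval (Sum.elim ![1, 0] (Pi.single S 1) : Fin 2 ⊕ KSub n k → AlgebraicClosure K) f = 0) :
    coord (AlgebraicClosure K) S.1 ∈ (Z.shift i j).points := by
  rw [coord_mem_points_iff, ← minors_coordRows]
  refine mem_cone_cutOut (linearIndependent_coordRows S) fun g hg _ => ?_
  have hsurj : Function.Surjective (aeval (Sum.elim ![1, 0] X) :
      MvPolynomial (Fin 2 ⊕ KSub n k) K →ₐ[K] PRing K n k) := by
    intro g
    refine ⟨rename Sum.inr g, ?_⟩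
    rw [aeval_rename]
    exact aeval_X_left_apply g
  obtain ⟨f, hf, rfl⟩ := (Ideal.mem_map_iff_of_surjective _ hsurj).mp hg
  rw [minors_coordRows, ← h f hf, ← AlgHom.comp_apply, comp_aeval]
  congr 2
  funext v
  rcases v with a | U
  · fin_cases a <;> simp
  · simp

/-- The fixed point `coord S` lies on the shift if, for each `s ≠ 0`, the point `s v + e_S` of a
curve through the basis vector `e_S` lies on the translate of the cone by `exp (s⁻¹ e_ij)`. -/
theorem coord_mem_shift_points_of_curve [DecidableEq (KSub n k)] {S : KSub n k}
    (v : KSub n k → AlgebraicClosure K)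
    (h : ∀ s : AlgebraicClosure K, s ≠ 0 → ∃ y ∈ cone Z (AlgebraicClosure K),
      actCoord y (Matrix.transvection i j s⁻¹) = s • v + Pi.single S 1) :
    coord (AlgebraicClosure K) S.1 ∈ (Z.shift i j).points := by
  refine coord_mem_shift_points fun f hf => ?_
  have := aeval_eval_zero_of_forall_ne f (Sum.elim ![1, Polynomial.X] fun U =>
    Polynomial.X * Polynomial.C (v U) + Polynomial.C ((Pi.single S 1 : KSub n k → _) U)) (by
      intro s hs
      obtain ⟨y, hy, hyS⟩ := h s hs
      rw [← aeval_familyIdeal hy hf s⁻¹ s, hyS]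
      congr 2
      funext w
      rcases w with a | U
      · fin_cases a <;> simp [hs]
      · simp
        exact mul_comm _ _)
  refine Eq.trans ?_ this
  congr 2
  funext w
  rcases w with a | U
  · fin_cases a <;> simp
  · simp

theorem coord_mem_shift_points_of_fixed (hij : i ≠ j) {S : KSub n k}
    (hS : ¬ (i ∈ S.1 ∧ j ∉ S.1)) (hSZ : coord (AlgebraicClosure K) S.1 ∈ Z.points) :
    coord (AlgebraicClosure K) S.1 ∈ (Z.shift i j).points := by
  classical
  refine coord_mem_shift_points_of_curve 0 fun s _ =>
    ⟨Pi.single S 1, (coord_mem_points_iff S).mp hSZ, ?_⟩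
  rw [actCoord_single_of_fixed hij hS, smul_zero, zero_add]

/-- The curve `exp (t e_ij) · coord S` tends to `coord (S \ i ∪ j)`. -/
theorem coord_replace_mem_shift_points (hij : i ≠ j) {S : KSub n k} (hi : i ∈ S.1) (hj : j ∉ S.1)
    (hSZ : coord (AlgebraicClosure K) S.1 ∈ Z.points) :
    coord (AlgebraicClosure K) (replace i j S hi hj).1 ∈ (Z.shift i j).points := by
  classical
  obtain ⟨ε, hε⟩ := exists_actCoord_single hij hi hj
  have hε2 : (((ε : ℤ) : AlgebraicClosure K)) * ((ε : ℤ) : AlgebraicClosure K) = 1 := by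
    rw [← Int.cast_mul, ← Units.val_mul, Int.units_mul_self, Units.val_one, Int.cast_one]
  -- Scaling `e_S ± s⁻¹ e_T`, where `T = S \ i ∪ j`, by `± s` gives `± s e_S + e_T`.
  refine coord_mem_shift_points_of_curve (((ε : ℤ) : AlgebraicClosure K) • Pi.single S 1)
    fun s hs => ⟨(s * ((ε : ℤ) : AlgebraicClosure K)) • Pi.single S 1,
      smul_mem_cone ((coord_mem_points_iff S).mp hSZ) _, ?_⟩
  rw [actCoord_smul, hε, smul_add, smul_smul]
  congr 1
  rw [← Pi.single_smul', smul_eq_mul]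
  congr 1
  field_simp
  rw [pow_two, hε2]

/-- If both `coord S` and `coord (S \ i ∪ j)` are on a `T`-convex subscheme, then `coord S` is the
constant limit of translates of points of the line through them. -/
theorem coord_mem_shift_points_of_tConvex (hc : TConvex k Z.points) (hij : i ≠ j) {S : KSub n k}
    (hi : i ∈ S.1) (hj : j ∉ S.1) (hSZ : coord (AlgebraicClosure K) S.1 ∈ Z.points)
    (hSZ' : coord (AlgebraicClosure K) (replace i j S hi hj).1 ∈ Z.points) :
    coord (AlgebraicClosure K) S.1 ∈ (Z.shift i j).points := by
  classical
  refine coord_mem_shift_points_of_curve 0 fun s _ =>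
    ⟨actCoord (Pi.single S 1) (Matrix.transvection i j (-s⁻¹)),
      actCoord_single_mem_cone_of_tConvex hc (M := S.1.erase i) (Finset.notMem_erase _ _)
        (fun h => hj (Finset.mem_of_mem_erase h)) hij (Finset.insert_erase hi).symm rfl hSZ hSZ' _,
      ?_⟩
  rw [← actCoord_mul, Matrix.transvection_mul_transvection_same _ _ hij, neg_add_cancel,
    Matrix.transvection_zero, actCoord_one, smul_zero, zero_add]

theorem mem_shift_ideal {f : MvPolynomial (Fin 2 ⊕ KSub n k) K} (hf : f ∈ Z.familyIdeal i j)
    {g : PRing K n k} (hg : aeval (Sum.elim ![1, 0] X) f = g) {d : ℕ} (hd : g.IsHomogeneous d) :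
    g ∈ (Z.shift i j).ideal :=
  mem_cutOut_ideal (hg ▸ Ideal.mem_map_of_mem _ hf) hd

theorem coord_notMem_shift_points {S : KSub n k} {p : ℕ}
    (h : ClosedSubscheme.expCoord (K := K) i j S ^ p ∈
      Z.ideal.map (C : PRing K n k →+* MvPolynomial (Fin 2) (PRing K n k))) :
    coord (AlgebraicClosure K) S.1 ∉ (Z.shift i j).points := by
  refine coord_notMem_points_of_pow_mem (p := p)
    (mem_shift_ideal (f := X (Sum.inr S) ^ p) ?_ ?_ (isHomogeneous_X_pow S p))
  · rw [mem_familyIdeal, map_pow, aeval_X]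
    exact h
  · simp

theorem coord_notMem_shift_points_of_fixed (hT : Z.IsTorusInvariant) (hij : i ≠ j) {S : KSub n k}
    (hS : ¬ (j ∈ S.1 ∧ i ∉ S.1)) (hSZ : coord (AlgebraicClosure K) S.1 ∉ Z.points) :
    coord (AlgebraicClosure K) S.1 ∉ (Z.shift i j).points := by
  rw [coord_mem_points_iff_forall_pow hT] at hSZ
  push Not at hSZ
  obtain ⟨p, hp⟩ := hSZ
  refine coord_notMem_shift_points (p := p) ?_
  rw [expCoord_of_fixed hij hS, ← map_pow]
  exact Ideal.mem_map_of_mem _ hp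

/-- Let `T = S \ i ∪ j`. If `p_T` is nilpotent on the subscheme, then so is `s₁ p_T ∓ s₀ p_S` on
the family, and its restriction to the fibre over `∞` is `∓ p_S`. -/
theorem coord_notMem_shift_points_of_replace (hT : Z.IsTorusInvariant) (hij : i ≠ j)
    {S : KSub n k} (hi : i ∈ S.1) (hj : j ∉ S.1)
    (hSZ : coord (AlgebraicClosure K) (replace i j S hi hj).1 ∉ Z.points) :
    coord (AlgebraicClosure K) S.1 ∉ (Z.shift i j).points := by
  rw [coord_mem_points_iff_forall_pow hT] at hSZ
  push Not at hSZ
  obtain ⟨p, hp⟩ := hSZ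
  obtain ⟨ε, hε⟩ := exists_aeval_relation (K := K) hij hi hj
  have hmem : (-(((ε : ℤ) : PRing K n k) * X S)) ^ p ∈ (Z.shift i j).ideal := by
    refine mem_shift_ideal (f := (X (Sum.inl 1) * X (Sum.inr (replace i j S hi hj)) -
        ((ε : ℤ) : MvPolynomial (Fin 2 ⊕ KSub n k) K) * (X (Sum.inl 0) * X (Sum.inr S))) ^ p)
      ?_ ?_ (d := 1 * p) ?_
    · rw [mem_familyIdeal, map_pow, hε, mul_pow, ← map_pow]
      exact Ideal.mul_mem_left _ _ (Ideal.mem_map_of_mem _ hp)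
    · simp
    · refine IsHomogeneous.pow (IsHomogeneous.neg ?_) p
      have := (isHomogeneous_X K S).C_mul ((ε : ℤ) : K)
      rwa [map_intCast] at this
  refine coord_notMem_points_of_pow_mem (p := p) ?_
  have h := Ideal.mul_mem_left _ ((-((ε : ℤ) : PRing K n k)) ^ p) hmem
  have hε2 : ((ε : ℤ) : PRing K n k) * ((ε : ℤ) : PRing K n k) = 1 := by
    rw [← Int.cast_mul, ← Units.val_mul, Int.units_mul_self, Units.val_one, Int.cast_one]
  rwa [← mul_pow, neg_mul_neg, ← mul_assoc, hε2, one_mul] at h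

/-- If `p_S` and `p_U`, where `U = S \ j ∪ i`, are nilpotent on the subscheme, then so is the
pullback `p_S ± t p_U` of `p_S` along `exp (t e_ij)`. -/
theorem coord_notMem_shift_points_of_both (hT : Z.IsTorusInvariant) {S : KSub n k}
    (hj : j ∈ S.1) (hi : i ∉ S.1) (hSZ : coord (AlgebraicClosure K) S.1 ∉ Z.points)
    (hSZ' : coord (AlgebraicClosure K) (replace j i S hj hi).1 ∉ Z.points) :
    coord (AlgebraicClosure K) S.1 ∉ (Z.shift i j).points := by
  rw [coord_mem_points_iff_forall_pow hT] at hSZ hSZ'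
  push Not at hSZ hSZ'
  obtain ⟨p, hp⟩ := hSZ
  obtain ⟨q, hq⟩ := hSZ'
  obtain ⟨ε, hε⟩ := exists_expCoord (K := K) hj hi rfl
  have hrad : ∀ (U : KSub n k) (r : ℕ), (X U : PRing K n k) ^ r ∈ Z.ideal →
      (C (X U) : MvPolynomial (Fin 2) (PRing K n k)) ∈ (Z.ideal.map C).radical := by
    intro U r hr
    refine ⟨r, ?_⟩
    rw [← map_pow]
    exact Ideal.mem_map_of_mem _ hr
  have hmem : ClosedSubscheme.expCoord (K := K) i j S ∈
      (Z.ideal.map (C : PRing K n k →+* MvPolynomial (Fin 2) (PRing K n k))).radical := by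
    rw [hε]
    exact Ideal.add_mem _ (hrad _ _ hp) (Ideal.mul_mem_left _ _ (hrad _ _ hq))
  obtain ⟨r, hr⟩ := hmem
  exact coord_notMem_shift_points hr

theorem coordInv_shift (hT : Z.IsTorusInvariant) (hc : TConvex k Z.points) (hij : i ≠ j) :
    coordInv k (Z.shift i j).points = shiftColl i j (coordInv k Z.points) := by
  have hmem : ∀ U : KSub n k, U.1 ∈ coordInv k Z.points ↔
      coord (AlgebraicClosure K) U.1 ∈ Z.points := fun U => ⟨fun h => h.2, fun h => ⟨U.2, h⟩⟩
  have hfix : ∀ U : KSub n k, ¬ (i ∈ U.1 ∧ j ∉ U.1) → shiftSet i j U.1 = U.1 := fun U hU => by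
    rw [shiftSet_eq hij, if_neg hU]
  ext S
  constructor
  · rintro ⟨hcard, hS⟩
    obtain ⟨U, rfl⟩ : ∃ U : KSub n k, U.1 = S := ⟨⟨S, hcard⟩, rfl⟩
    by_cases hU : i ∈ U.1 ∧ j ∉ U.1
    · have h1 : coord (AlgebraicClosure K) U.1 ∈ Z.points := by
        by_contra h
        exact coord_notMem_shift_points_of_fixed hT hij (fun h' => hU.2 h'.1) h hS
      have h2 : coord (AlgebraicClosure K) (replace i j U hU.1 hU.2).1 ∈ Z.points := by
        by_contra h
        exact coord_notMem_shift_points_of_replace hT hij hU.1 hU.2 h hS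
      refine ⟨U.1, (hmem U).mpr h1, if_pos ?_⟩
      rw [shiftSet_replace hij hU.1 hU.2]
      exact (hmem _).mpr h2
    · by_cases h1 : coord (AlgebraicClosure K) U.1 ∈ Z.points
      · refine ⟨U.1, (hmem U).mpr h1, if_pos ?_⟩
        rw [hfix U hU]
        exact (hmem U).mpr h1
      · have hjU : j ∈ U.1 ∧ i ∉ U.1 := by
          by_contra h
          exact coord_notMem_shift_points_of_fixed hT hij h h1 hS
        have h2 : coord (AlgebraicClosure K) (replace j i U hjU.1 hjU.2).1 ∈ Z.points := by
          by_contra h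
          exact coord_notMem_shift_points_of_both hT hjU.1 hjU.2 h1 h hS
        have h3 : shiftSet i j (replace j i U hjU.1 hjU.2).1 = U.1 := by
          rw [shiftSet_replace hij (mem_replace hjU.1 hjU.2)
            (notMem_replace hij.symm hjU.1 hjU.2), replace_replace hij.symm]
        refine ⟨_, (hmem _).mpr h2, (if_neg ?_).trans h3⟩
        rw [h3, hmem]
        exact h1
  · rintro ⟨S', hS', rfl⟩
    obtain ⟨U, rfl⟩ : ∃ U : KSub n k, U.1 = S' := ⟨⟨S', hS'.1⟩, rfl⟩
    have hUZ := (hmem U).mp hS'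
    by_cases hU : i ∈ U.1 ∧ j ∉ U.1
    · dsimp only
      split_ifs with h
      · rw [shiftSet_replace hij hU.1 hU.2, hmem] at h
        exact ⟨U.2, coord_mem_shift_points_of_tConvex hc hij hU.1 hU.2 hUZ h⟩
      · rw [shiftSet_replace hij hU.1 hU.2]
        exact ⟨(replace i j U hU.1 hU.2).2, coord_replace_mem_shift_points hij hU.1 hU.2 hUZ⟩
    · simp only [hfix U hU, ite_self]
      exact ⟨U.2, coord_mem_shift_points_of_fixed hij hU hUZ⟩

end Family

/-! ### Function fields of the family and the sweep -/

section Degree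

variable {K : Type u} [Field K] {n k : ℕ} {Z : ClosedSubscheme K n k} {i j : Fin n}

/-- If the shift does not preserve the collection of fixed points, then for some fixed
point `coord S` on the subscheme the limit `coord (S \ i ∪ j)` is not on the subscheme. -/
theorem exists_replace_notMem_points (hij : i ≠ j)
    (h : shiftColl i j (coordInv k Z.points) ≠ coordInv k Z.points) :
    ∃ (S : KSub n k) (hi : i ∈ S.1) (hj : j ∉ S.1),
      coord (AlgebraicClosure K) S.1 ∈ Z.points ∧
        coord (AlgebraicClosure K) (replace i j S hi hj).1 ∉ Z.points := by
  by_contra! hcon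
  apply h
  have hfix : ∀ S ∈ coordInv k Z.points, shiftSet i j S ∈ coordInv k Z.points := by
    rintro S ⟨hcard, hS⟩
    by_cases hS' : i ∈ S ∧ j ∉ S
    · have := hcon ⟨S, hcard⟩ hS'.1 hS'.2 hS
      have he := shiftSet_replace hij (S := ⟨S, hcard⟩) hS'.1 hS'.2
      change shiftSet i j S = _ at he
      rw [he]
      exact ⟨(replace i j ⟨S, hcard⟩ hS'.1 hS'.2).2, this⟩
    · rw [shiftSet_eq hij, if_neg hS']
      exact ⟨hcard, hS⟩
  unfold shiftColl
  conv_rhs => rw [← Set.image_id (coordInv k Z.points)]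
  exact Set.image_congr fun S hS => if_pos (hfix S hS)

theorem isPrime_map_C {R σ : Type*} [CommRing R] {I : Ideal R} (hI : I.IsPrime) :
    (I.map (C : R →+* MvPolynomial σ R)).IsPrime := by
  have h := MvPolynomial.ker_map (σ := σ) (Ideal.Quotient.mk I)
  rw [Ideal.mk_ker] at h
  rw [← h]
  exact RingHom.ker_isPrime _

theorem isPrime_familyIdeal (hZ : Z.IsVariety) : (Z.familyIdeal i j).IsPrime :=
  (isPrime_map_C hZ).comap _

theorem C_mem_map_iff {f : PRing K n k} :
    (C f : MvPolynomial (Fin 2) (PRing K n k)) ∈ Z.ideal.map C ↔ f ∈ Z.ideal := by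
  classical
  refine ⟨fun h => ?_, Ideal.mem_map_of_mem _⟩
  have := mem_map_C_iff.mp h 0
  rwa [coeff_zero_C] at this

theorem X_inl_one_notMem_familyIdeal (hZ : Z.IsVariety) :
    X (Sum.inl 1) ∉ Z.familyIdeal i j := by
  classical
  intro h
  rw [mem_familyIdeal, aeval_X, mem_map_C_iff] at h
  have := h (Finsupp.single 1 1)
  rw [Sum.elim_inl, Matrix.cons_val_one, Matrix.cons_val_fin_one, coeff_X, if_pos rfl] at this
  exact hZ.ne_top ((Ideal.eq_top_iff_one _).mpr this)

theorem X_inr_notMem_familyIdeal (hij : i ≠ j) {S : KSub n k} (hS : ¬ (j ∈ S.1 ∧ i ∉ S.1))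
    (h : X S ∉ Z.ideal) : X (Sum.inr S) ∉ Z.familyIdeal i j := by
  rw [mem_familyIdeal, aeval_X, Sum.elim_inr, expCoord_of_fixed hij hS, C_mem_map_iff]
  exact h

/-- The bigrading of the coordinate ring of `ℙ¹ × Gr`. -/
abbrev bidegree : Fin 2 ⊕ KSub n k → ℕ × ℕ := Sum.elim (fun _ => (1, 0)) fun _ => (0, 1)

theorem isHomogeneous_of_isWeightedHomogeneous_bidegree {d : ℕ × ℕ}
    {f : MvPolynomial (Fin 2 ⊕ KSub n k) K} (hf : f.IsWeightedHomogeneous bidegree d) :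
    f.IsHomogeneous (d.1 + d.2) := by
  intro ν hν
  have h := hf hν
  rw [← h, Finsupp.weight_eq_sum, Finsupp.weight_eq_sum]
  simp [Prod.fst_sum, Prod.snd_sum]

/-- The substitution `s₀ = ε p_T`, `s₁ = p_S`, which eliminates the coordinates of `ℙ¹`. -/
noncomputable def eliminate (ε : ℤˣ) (S T : KSub n k) :
    MvPolynomial (Fin 2 ⊕ KSub n k) K →ₐ[K] PRing K n k :=
  aeval (Sum.elim ![((ε : ℤ) : PRing K n k) * X T, X S] X)

theorem isHomogeneous_eliminate (ε : ℤˣ) (S T : KSub n k) {d : ℕ × ℕ}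
    {f : MvPolynomial (Fin 2 ⊕ KSub n k) K} (hf : f.IsWeightedHomogeneous bidegree d) :
    (eliminate ε S T f).IsHomogeneous (d.1 + d.2) := by
  have h := (isHomogeneous_of_isWeightedHomogeneous_bidegree hf).aeval
    (Sum.elim ![((ε : ℤ) : PRing K n k) * X T, X S] X) (n := 1) ?_
  · rwa [one_mul] at h
  · rintro (a | U)
    · fin_cases a
      · have := (isHomogeneous_X K T).C_mul ((ε : ℤ) : K)
        rwa [map_intCast] at this
      · exact isHomogeneous_X K S
    · exact isHomogeneous_X K U

/-- Where `s₁ p_T = ε s₀ p_S`, eliminating the coordinates of `ℙ¹` from a bihomogeneous form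
multiplies its value by a power of `p_S / s₁`. -/
theorem eliminate_eq {E : Type*} [Field E] [Algebra K E] {ε : ℤˣ} {S T : KSub n k}
    (φ : MvPolynomial (Fin 2 ⊕ KSub n k) K →ₐ[K] E) (h1 : φ (X (Sum.inl 1)) ≠ 0)
    (hrel : φ (X (Sum.inl 1) * X (Sum.inr T) -
      ((ε : ℤ) : MvPolynomial (Fin 2 ⊕ KSub n k) K) * (X (Sum.inl 0) * X (Sum.inr S))) = 0)
    {d : ℕ × ℕ} {f : MvPolynomial (Fin 2 ⊕ KSub n k) K}
    (hf : f.IsWeightedHomogeneous bidegree d) :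
    φ (rename Sum.inr (eliminate ε S T f)) =
      (φ (X (Sum.inr S)) / φ (X (Sum.inl 1))) ^ d.1 * φ f := by
  have hε2 : ((ε : ℤ) : E) * ((ε : ℤ) : E) = 1 := by
    rw [← Int.cast_mul, ← Units.val_mul, Int.units_mul_self, Units.val_one, Int.cast_one]
  simp only [map_sub, map_mul, map_intCast, sub_eq_zero] at hrel
  have key := aeval_mul_of_isWeightedHomogeneous (K := K) hf
    ((powersHom E (φ (X (Sum.inr S)) / φ (X (Sum.inl 1)))).comp
      (AddMonoidHom.toMultiplicative (AddMonoidHom.fst ℕ ℕ))) fun v => φ (X v)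
  have hφ : (aeval fun v => φ (X v)) f = φ f := (DFunLike.congr_fun (aeval_unique φ) f).symm
  rw [hφ] at key
  refine Eq.trans ?_ key
  rw [eliminate, ← AlgHom.comp_apply, ← AlgHom.comp_apply, comp_aeval]
  congr 2
  funext v
  rcases v with a | U
  · fin_cases a
    · simp
      rw [div_mul_eq_mul_div, eq_div_iff h1]
      linear_combination ((ε : ℤ) : E) * hrel +
        φ (X (Sum.inr S)) * φ (X (Sum.inl 0)) * hε2
    · simp [h1]
  · simp

/-- On the family, the coordinate `s₀ / s₁ = ε p_T / p_S` of `ℙ¹` is a rational function on the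
sweep. -/
theorem functionField_le_map [hW : (Z.familyIdeal i j).IsPrime] (hij : i ≠ j)
    [hP : (Z.sweep hij).ideal.IsPrime] {ε : ℤˣ} {S T : KSub n k}
    (h1 : X (Sum.inl 1) ∉ Z.familyIdeal i j) (hS : X (Sum.inr S) ∉ Z.familyIdeal i j)
    (hrel : X (Sum.inl 1) * X (Sum.inr T) -
      ((ε : ℤ) : MvPolynomial (Fin 2 ⊕ KSub n k) K) * (X (Sum.inl 0) * X (Sum.inr S))
        ∈ Z.familyIdeal i j) :
    functionField bidegree (Z.familyIdeal i j) ≤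
      (functionField (fun _ => (1 : ℕ)) (Z.sweep hij).ideal).map (Z.sweepPullback hij) := by
  let E := FractionRing (MvPolynomial (Fin 2 ⊕ KSub n k) K ⧸ Z.familyIdeal i j)
  let φ : MvPolynomial (Fin 2 ⊕ KSub n k) K →ₐ[K] E :=
    (IsScalarTower.toAlgHom K (MvPolynomial (Fin 2 ⊕ KSub n k) K ⧸ Z.familyIdeal i j) E).comp
      (Ideal.Quotient.mkₐ K (Z.familyIdeal i j))
  have hφ0 : ∀ f, φ f = 0 ↔ f ∈ Z.familyIdeal i j := by
    intro f
    rw [← Ideal.Quotient.eq_zero_iff_mem]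
    exact FaithfulSMul.algebraMap_eq_zero_iff
      (MvPolynomial (Fin 2 ⊕ KSub n k) K ⧸ Z.familyIdeal i j) E
  have hpull : ∀ f : PRing K n k, Z.sweepPullback hij
      (algebraMap _ _ (Ideal.Quotient.mk (Z.sweep hij).ideal f)) = φ (rename Sum.inr f) := by
    intro f
    have hinj : Function.Injective (Ideal.quotientMap (I := (Z.sweep hij).ideal)
        (Z.familyIdeal i j) (rename Sum.inr : PRing K n k →ₐ[K] _).toRingHom le_rfl) :=
      Ideal.quotientMap_injective
    exact IsLocalization.map_eq (S := FractionRing (PRing K n k ⧸ (Z.sweep hij).ideal)) (Q := E)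
      (nonZeroDivisors_le_comap_nonZeroDivisors_of_injective _ hinj)
      (Ideal.Quotient.mk (Z.sweep hij).ideal f)
  have hu : φ (X (Sum.inr S)) / φ (X (Sum.inl 1)) ≠ 0 :=
    div_ne_zero (fun h => hS ((hφ0 _).mp h)) fun h => h1 ((hφ0 _).mp h)
  have helim : ∀ (d : ℕ × ℕ) (f : MvPolynomial (Fin 2 ⊕ KSub n k) K),
      f.IsWeightedHomogeneous bidegree d → φ (rename Sum.inr (eliminate ε S T f)) =
        (φ (X (Sum.inr S)) / φ (X (Sum.inl 1))) ^ d.1 * φ f := fun d f hf =>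
    eliminate_eq φ (fun h => h1 ((hφ0 _).mp h)) ((hφ0 _).mpr hrel) hf
  rintro _ ⟨d, a, b, ha, hb, hbW, rfl⟩
  refine ⟨_, ⟨d.1 + d.2, eliminate ε S T a, eliminate ε S T b, isHomogeneous_eliminate ε S T ha,
    isHomogeneous_eliminate ε S T hb, fun h => ?_, rfl⟩, ?_⟩
  · have h0 : φ (rename Sum.inr (eliminate ε S T b)) = 0 := (hφ0 _).mpr h
    rw [helim d b hb] at h0
    exact hbW ((hφ0 b).mp ((mul_eq_zero.mp h0).resolve_left (pow_ne_zero _ hu)))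
  · rw [map_div₀, hpull, hpull, helim d a ha, helim d b hb,
      mul_div_mul_left _ _ (pow_ne_zero _ hu)]
    rfl

theorem exists_sweepDegree_eq_one (hT : Z.IsTorusInvariant) (hZ : Z.IsVariety) (hij : i ≠ j)
    (h : shiftColl i j (coordInv k Z.points) ≠ coordInv k Z.points) :
    ∃ (hW : Z.FamilyIsVariety i j) (hS : (Z.sweep hij).IsVariety),
      Z.sweepDegree hij hW hS = 1 := by
  obtain ⟨S, hi, hj, hS, hS'⟩ := exists_replace_notMem_points hij h
  rw [coord_mem_points_iff_forall_pow hT] at hS hS'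
  push Not at hS'
  obtain ⟨p, hp⟩ := hS'
  have hXT : X (replace i j S hi hj) ∈ Z.ideal := Ideal.IsPrime.mem_of_pow_mem hZ p hp
  have hXS : X S ∉ Z.ideal := by simpa using hS 1
  have hW : (Z.familyIdeal i j).IsPrime := isPrime_familyIdeal hZ
  have hP : (Z.sweep hij).ideal.IsPrime := hW.comap _
  have h1 := X_inl_one_notMem_familyIdeal (i := i) (j := j) hZ
  have h2 := X_inr_notMem_familyIdeal hij (fun h => hj h.1) hXS
  refine ⟨⟨hW, ⟨1, h1⟩, ⟨S, h2⟩⟩, hP, ?_⟩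
  obtain ⟨ε, hε⟩ := exists_aeval_relation (K := K) hij hi hj
  refine Subfield.relfinrank_eq_one_iff.mpr (functionField_le_map hij h1 h2 (ε := ε) (T :=
    replace i j S hi hj) ?_)
  rw [mem_familyIdeal, hε]
  exact Ideal.mul_mem_left _ _ (Ideal.mem_map_of_mem _ hXT)

end Degree

end GrassmannShift

open GrassmannShift in
theorem mainTheorem9 {K : Type*} [Field K] {n k : ℕ} (Z : ClosedSubscheme K n k)
    (hT : Z.IsTorusInvariant) :
    (Z.IsIrreducible → TConvex k Z.points) ∧
    (Z.IsDefinedByPluckerCoords → TConvex k Z.points) ∧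
    (TConvex k Z.points → ∀ i j : Fin n, i ≠ j →
      coordInv k (torusFixed (Z.shift i j).points) =
        shiftColl i j (coordInv k (torusFixed Z.points))) ∧
    (Z.IsVariety → ∀ (i j : Fin n) (hij : i ≠ j),
      shiftColl i j (coordInv k (torusFixed Z.points)) ≠ coordInv k (torusFixed Z.points) →
      ∃ (hW : Z.FamilyIsVariety i j) (hS : (Z.sweep hij).IsVariety),
        Z.sweepDegree hij hW hS = 1) := by
  simp only [coordInv_torusFixed]
  exact ⟨tConvex_of_isIrreducible hT, tConvex_of_isDefinedByPluckerCoords,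
    fun hc i j hij => coordInv_shift hT hc hij,
    fun hZ i j hij h => exists_sweepDegree_eq_one hT hZ hij h⟩
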